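/- Let $\mathbb{F}_q$ be a finite field, $A=\mathbb{F}_q[\theta]$, and let $A_+$ be the set of monic elements of $A$. Let $A[\tau]$ be the twisted polynomial ring with $\tau c=c^q\tau$ for $c\in A$. Let $\phi:A\to A[\tau]$ be a Drinfeld module of rank $r\ge 1$, i.e. a homomorphism of $\mathbb{F}_q$-algebras with $\phi_\theta=\theta+\kappa_1\tau+\cdots+\kappa_r\tau^r$, $\kappa_r\neq 0$. For $a\in A$ write $\phi_a=\sum_{k\ge 0}[a;k]\,\tau^k$ with $[a;k]\in A$ (so $[a;k]=0$ for $k>r\deg a$). Let $C$ be the Carlitz module, $C_\theta=\theta+\tau$; if $C_a=\sum_k c_k\tau^k$, put $C_a(x)=\sum_k c_k x^{q^k}$, and for a polynomial $\beta$ in $x$ put $(a\star\beta)(x)=\beta(C_a(x))$. Let $f\in A_+$ be irreducible of degree $d$, let $\mathbb{F}_f=A/(f)$, and let $A_{(f)}$ be the localization of $A$ at the prime ideal $(f)$. Let $\bar\phi:A\to\mathbb{F}_f[\tau]$ be the reduction of $\phi$ modulo $f$, and let $r_0$ be its rank, i.e. the largest $k\geq 1$ with $f\nmid\kappa_k$,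 or $r_0=0$ if there is none. If $r_0=0$ put $P_f(x)=1$. If $r_0\ge 1$, there are a monic polynomial $P_f(x)=x^{r_0}+a_{r_0-1}x^{r_0-1}+\cdots+a_0\in A[x]$ and $c_f\in\mathbb{F}_q^\times$ such that, for every irreducible $\lambda\in A_+$ with $\lambda\ne f$, $P_f$ is the characteristic polynomial of the Frobenius $\tau^d$ acting on the Tate module $T_\lambda(\bar\phi)$ (a finite free module over the completion $A_\lambda$), and $a_0=c_f^{-1}f$. For $1\le\ell\le r$ put \[ b_\ell=\begin{cases}-c_f a_\ell & \text{if } 1\le\ell\le r_0-1,\\ -c_f & \text{if } \ell=r_0,\\ 0 & \text{if } r_0<\ell\le r.\end{cases} \] Then the following hold. (a) For $0\le k\le d-1$, $[f;k]\equiv 0 \pmod f$. (b) For $0\le k\le rd$, \[ [f;k]-\sum_{\ell=1}^{\lfloor k/d\rfloor}[b_\ell;k-\ell d]\equiv 0\pmod f . \] (c) For every $P(x)\in A_{(f)}[x]$ and $0\le k\le rd$, \[ [f;k]\,P(x)^{q^k}-\sum_{\ell=1}^{\lfloor k/d\rfloor}[b_\ell;k-\ell d]\,\bigl(f^\ell\star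 P(x)^{q^{k-\ell d}}\bigr)\in f A_{(f)}[x]. \] -/

import Mathlib

noncomputable section

open Polynomial

namespace Drinfeld

/-! ### Twisted polynomials

Throughout, `Fq` is a finite field with `q = Fintype.card Fq` elements and `A = Fq[X]`; the
variable `X` of `A` is the element written `θ` in the mathematics. -/

section Twisted

variable {Fq : Type*} [Field Fq] [Fintype Fq]

/-- The powers of the `q`-th power Frobenius acting on `A = Fq[θ]`: `n • a = a ^ (q ^ n)`. -/
instance frobeniusAction : MulSemiringAction (Multiplicative ℕ) Fq[X] where
  smul n a := a ^ (Fintype.card Fq ^ n.toAdd)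
  one_smul a := by
    change a ^ (Fintype.card Fq ^ 0) = a
    simp
  mul_smul m n a := by
    change a ^ (Fintype.card Fq ^ (m.toAdd + n.toAdd)) =
      (a ^ (Fintype.card Fq ^ n.toAdd)) ^ (Fintype.card Fq ^ m.toAdd)
    rw [← pow_mul, ← pow_add, add_comm]
  smul_zero n := by
    change (0 : Fq[X]) ^ (Fintype.card Fq ^ n.toAdd) = 0
    exact zero_pow (pow_ne_zero _ Fintype.card_ne_zero)
  smul_add n a b := by
    change (a + b) ^ (Fintype.card Fq ^ n.toAdd) =
      a ^ (Fintype.card Fq ^ n.toAdd) + b ^ (Fintype.card Fq ^ n.toAdd)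
    have h : ∀ (m : ℕ) (y : Fq[X]),
        ((FiniteField.frobeniusAlgHom Fq Fq[X]) ^ m) y = y ^ (Fintype.card Fq ^ m) := by
      intro m y
      rw [AlgHom.coe_pow, FiniteField.coe_frobeniusAlgHom, pow_iterate]
    rw [← h, ← h, ← h, map_add]
  smul_one n := by
    change (1 : Fq[X]) ^ (Fintype.card Fq ^ n.toAdd) = 1
    exact one_pow _
  smul_mul n a b := by
    change (a * b) ^ (Fintype.card Fq ^ n.toAdd) =
      a ^ (Fintype.card Fq ^ n.toAdd) * b ^ (Fintype.card Fq ^ n.toAdd)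
    exact mul_pow _ _ _

theorem frobeniusAction_def (n : Multiplicative ℕ) (a : Fq[X]) :
    n • a = a ^ (Fintype.card Fq ^ n.toAdd) := rfl

instance : SMulCommClass (Multiplicative ℕ) Fq Fq[X] where
  smul_comm n c a := by
    rw [frobeniusAction_def, frobeniusAction_def, _root_.smul_pow, FiniteField.pow_card_pow]

variable (Fq) in
/-- The twisted polynomial ring `A[τ]` over `A = Fq[θ]`, in which `τ c = c ^ q τ`. It is an
`Fq`-algebra; `SkewPolynomial.monomial k c` is `c τ ^ k`, `SkewPolynomial.coeff u k` is the
coefficient of `τ ^ k` in `u`. -/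
abbrev TwistedPoly := SkewPolynomial Fq[X]

variable (Fq) in
/-- A Drinfeld module `φ : A → A[τ]` of rank `r` over `A`: a homomorphism of `Fq`-algebras with
`φ_θ = θ + κ_1 τ + ⋯ + κ_r τ ^ r` and `κ_r ≠ 0`. -/
structure DrinfeldModule (r : ℕ) where
  /-- The homomorphism `a ↦ φ_a`. -/
  toAlgHom : Fq[X] →ₐ[Fq] TwistedPoly Fq
  coeff_zero : SkewPolynomial.coeff (toAlgHom X) 0 = X
  coeff_rank_ne_zero : SkewPolynomial.coeff (toAlgHom X) r ≠ 0
  coeff_of_rank_lt : ∀ k, r < k → SkewPolynomial.coeff (toAlgHom X) k = 0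

/-- `brac φ a k` is the coefficient of `τ ^ k` in `φ_a`. -/
def DrinfeldModule.brac {r : ℕ} (φ : DrinfeldModule Fq r) (a : Fq[X]) (k : ℕ) : Fq[X] :=
  SkewPolynomial.coeff (φ.toAlgHom a) k

variable (Fq) in
/-- The Carlitz module, `C_θ = θ + τ`. -/
def carlitz : DrinfeldModule Fq 1 where
  toAlgHom := Polynomial.aeval
    (SkewPolynomial.monomial 0 (X : Fq[X]) + SkewPolynomial.monomial 1 (1 : Fq[X]))
  coeff_zero := by
    rw [Polynomial.aeval_X, SkewPolynomial.coeff_add, SkewPolynomial.coeff_monomial,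
      SkewPolynomial.coeff_monomial]
    simp
  coeff_rank_ne_zero := by
    rw [Polynomial.aeval_X, SkewPolynomial.coeff_add, SkewPolynomial.coeff_monomial,
      SkewPolynomial.coeff_monomial]
    simp
  coeff_of_rank_lt k hk := by
    have h0 : (0 : ℕ) ≠ k := by omega
    have h1 : (1 : ℕ) ≠ k := by omega
    rw [Polynomial.aeval_X, SkewPolynomial.coeff_add, SkewPolynomial.coeff_monomial,
      SkewPolynomial.coeff_monomial, if_neg h0, if_neg h1, add_zero]

/-- The polynomial `C_a(x) = ∑_k c_k x ^ (q ^ k)` attached to `C_a = ∑_k c_k τ ^ k`, where `C` is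
the Carlitz module. -/
def carlitzPoly (a : Fq[X]) : Fq[X][X] :=
  ∑ k ∈ SkewPolynomial.support ((carlitz Fq).toAlgHom a),
    Polynomial.monomial (Fintype.card Fq ^ k) ((carlitz Fq).brac a k)

/-- Anderson's operation `(a ⋆ β)(x) = β(C_a(x))`, for polynomials `β` over an `A`-algebra. -/
def star {B : Type*} [CommRing B] [Algebra Fq[X] B] (a : Fq[X]) (β : B[X]) : B[X] :=
  β.comp ((carlitzPoly a).map (algebraMap Fq[X] B))

/-! ### The `A`-module `φ(L)` -/

section Points

variable (L : Type*) [CommRing L] [Algebra Fq L]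

variable (Fq) in
/-- The `q`-th power Frobenius as an additive endomorphism. -/
def frob : AddMonoid.End L := ((FiniteField.frobeniusAlgHom Fq L : L →+* L) : L →+ L)

theorem endMul_apply (g h : AddMonoid.End L) (x : L) : (g * h) x = g (h x) := rfl

theorem frob_pow_apply (n : ℕ) (x : L) :
    (frob Fq L ^ n) x = x ^ (Fintype.card Fq ^ n) := by
  induction n generalizing x with
  | zero => simp
  | succ n ih =>
    rw [pow_succ, endMul_apply, ih]
    change (x ^ Fintype.card Fq) ^ _ = _
    rw [← pow_mul, pow_succ, mul_comm]

variable [Algebra Fq[X] L]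

/-- The action of `A[τ]` on an `A`-algebra `L`: a twisted polynomial `∑_k c_k τ ^ k` acts by
`x ↦ ∑_k c_k x ^ (q ^ k)`. -/
def twistedAction : TwistedPoly Fq →+* AddMonoid.End L :=
  SkewMonoidAlgebra.liftNCRingHom (Module.toAddMonoidEnd Fq[X] L) (powersHom _ (frob Fq L))
    (by
      intro c n
      refine AddMonoidHom.ext fun x => ?_
      change (n • c) • (frob Fq L ^ n.toAdd) x = (frob Fq L ^ n.toAdd) (c • x)
      rw [frob_pow_apply, frob_pow_apply, frobeniusAction_def, Algebra.smul_def, Algebra.smul_def,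
        map_pow, mul_pow])

theorem endSum_apply (s : Finset ℕ) (g : ℕ → AddMonoid.End L) (x : L) :
    (∑ k ∈ s, g k) x = ∑ k ∈ s, g k x :=
  map_sum (AddMonoidHom.eval x : AddMonoid.End L →+ L) g s

theorem twistedAction_apply (u : TwistedPoly Fq) (x : L) :
    twistedAction L u x =
      ∑ k ∈ SkewPolynomial.support u,
        algebraMap Fq[X] L (SkewPolynomial.coeff u k) * x ^ (Fintype.card Fq ^ k) := by
  conv_lhs => rw [← SkewPolynomial.sum_monomial u, SkewPolynomial.sum_def]
  rw [map_sum, endSum_apply]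
  refine Finset.sum_congr rfl fun k _ => ?_
  have h : twistedAction L (SkewPolynomial.monomial k (SkewPolynomial.coeff u k)) =
      Module.toAddMonoidEnd Fq[X] L (SkewPolynomial.coeff u k) * frob Fq L ^ k :=
    SkewMonoidAlgebra.liftNC_single _ _ _ _
  rw [h, endMul_apply, frob_pow_apply, ← Algebra.smul_def]
  rfl

/-- The `A`-module `φ(L)`: the additive group of the `A`-algebra `L`, on which `a ∈ A` acts as
`φ_a`. -/
def DrinfeldModule.Points {r : ℕ} (_φ : DrinfeldModule Fq r) : Type _ := L

instance {r : ℕ} (φ : DrinfeldModule Fq r) : AddCommGroup (φ.Points L) :=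
  inferInstanceAs (AddCommGroup L)

instance {r : ℕ} (φ : DrinfeldModule Fq r) : Module Fq[X] (φ.Points L) :=
  Module.compHom (R := AddMonoid.End L) L ((twistedAction L).comp φ.toAlgHom.toRingHom)

/-- The identity map from `L` to `φ(L)`, an isomorphism of additive groups. -/
def DrinfeldModule.toPoints {r : ℕ} (φ : DrinfeldModule Fq r) : L ≃+ φ.Points L := AddEquiv.refl L

theorem DrinfeldModule.smul_toPoints {r : ℕ} (φ : DrinfeldModule Fq r) (a : Fq[X]) (x : L) :
    a • φ.toPoints L x = φ.toPoints L (∑ k ∈ SkewPolynomial.support (φ.toAlgHom a),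
      algebraMap Fq[X] L (φ.brac a k) * x ^ (Fintype.card Fq ^ k)) :=
  twistedAction_apply L (φ.toAlgHom a) x

end Points

end Twisted

/-! ### Tate modules -/

section Tate

variable {A : Type*} [CommRing A]

/-- The Tate module `T_l(M)` of an `A`-module `M` at `l ∈ A`: the inverse limit of the torsion
modules `M[l ^ n]` along multiplication by `l`, realized as the module of sequences `(x_n)` with
`x_0 = 0` and `l x_{n+1} = x_n`. -/
def tateSubmodule (l : A) (M : Type*) [AddCommGroup M] [Module A M] : Submodule A (ℕ → M) where
  carrier := {x | x 0 = 0 ∧ ∀ n, l • x (n + 1) = x n}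
  add_mem' := by
    rintro x y ⟨hx, hx'⟩ ⟨hy, hy'⟩
    exact ⟨by simp [hx, hy], fun n => by simp [smul_add, hx', hy']⟩
  zero_mem' := ⟨rfl, fun n => by simp⟩
  smul_mem' := by
    rintro a x ⟨hx, hx'⟩
    exact ⟨by simp [hx], fun n => by simp [smul_comm l a, hx']⟩

/-- The underlying type of the Tate module. -/
def TateModule (l : A) (M : Type*) [AddCommGroup M] [Module A M] : Type _ := tateSubmodule l M

namespace TateModule

variable {l : A} {M : Type*} [AddCommGroup M] [Module A M]

instance : AddCommGroup (TateModule l M) := inferInstanceAs (AddCommGroup (tateSubmodule l M))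

/-- The `n`-th term of an element of the Tate module, a point of `M[l ^ n]`. -/
def term (x : TateModule l M) (n : ℕ) : M := x.1 n

@[ext] theorem ext {x y : TateModule l M} (h : ∀ n, x.term n = y.term n) : x = y :=
  Subtype.ext (funext h)

theorem term_add (x y : TateModule l M) (n : ℕ) : (x + y).term n = x.term n + y.term n := rfl

theorem term_zero' (n : ℕ) : (0 : TateModule l M).term n = 0 := rfl

theorem smul_term_succ (x : TateModule l M) (n : ℕ) : l • x.term (n + 1) = x.term n := x.2.2 n

theorem pow_smul_term (x : TateModule l M) (n : ℕ) : l ^ n • x.term n = 0 := by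
  induction n with
  | zero => rw [pow_zero, one_smul]; exact x.2.1
  | succ n ih => rw [pow_succ, mul_smul, smul_term_succ, ih]

/-- A representative in `A` of the class modulo `l ^ n` of an element of the completion `A_l`. -/
def rep (n : ℕ) (a : AdicCompletion (Ideal.span {l}) A) : A :=
  Quotient.out (AdicCompletion.evalₐ (Ideal.span {l}) n a)

theorem mk_rep (n : ℕ) (a : AdicCompletion (Ideal.span {l}) A) :
    Ideal.Quotient.mk (Ideal.span {l} ^ n) (rep n a) =
      AdicCompletion.evalₐ (Ideal.span {l}) n a :=
  Quotient.out_eq _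

theorem smul_term_congr (x : TateModule l M) (n : ℕ) {a b : A}
    (h : Ideal.Quotient.mk (Ideal.span {l} ^ n) a = Ideal.Quotient.mk (Ideal.span {l} ^ n) b) :
    a • x.term n = b • x.term n := by
  rw [Ideal.Quotient.eq, Ideal.span_singleton_pow, Ideal.mem_span_singleton] at h
  obtain ⟨c, hc⟩ := h
  rw [← sub_eq_zero, ← sub_smul, hc, mul_comm, mul_smul, pow_smul_term, smul_zero]

/-- The completion `A_l` acts on the Tate module: on the `n`-th term, which is killed by `l ^ n`,
an element of `A_l` acts through its class modulo `l ^ n`. -/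
instance : SMul (AdicCompletion (Ideal.span {l}) A) (TateModule l M) where
  smul a x := ⟨fun n => rep n a • x.term n, by
    constructor
    · have h : x.term 0 = 0 := x.2.1
      simp [h]
    · intro n
      rw [smul_comm, smul_term_succ]
      apply smul_term_congr
      obtain ⟨c, rfl⟩ := AdicCompletion.mk_surjective (Ideal.span {l}) A a
      have h := mk_rep (n + 1) (AdicCompletion.mk (Ideal.span {l}) A c)
      rw [AdicCompletion.evalₐ_mk, Ideal.Quotient.eq] at h
      rw [mk_rep, AdicCompletion.evalₐ_mk, ← AdicCompletion.Ideal.mk_eq_mk _ (Nat.le_succ n),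
        Ideal.Quotient.eq]
      exact Ideal.pow_le_pow_right (Nat.le_succ n) h⟩

theorem smul_term (a : AdicCompletion (Ideal.span {l}) A) (x : TateModule l M) (n : ℕ) :
    (a • x).term n = rep n a • x.term n := rfl

instance : Module (AdicCompletion (Ideal.span {l}) A) (TateModule l M) where
  one_smul x := by
    ext n
    rw [smul_term, smul_term_congr x n (b := 1) (by rw [mk_rep, map_one, map_one]), one_smul]
  mul_smul a b x := by
    ext n
    rw [smul_term, smul_term, smul_term, ← mul_smul]
    exact smul_term_congr x n (by rw [mk_rep, map_mul, map_mul, mk_rep, mk_rep])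
  smul_zero a := by
    ext n
    rw [smul_term, term_zero', smul_zero]
  smul_add a x y := by
    ext n
    simp only [smul_term, term_add, smul_add]
  add_smul a b x := by
    ext n
    rw [smul_term, term_add, smul_term, smul_term, ← add_smul]
    exact smul_term_congr x n (by rw [mk_rep, map_add, map_add, mk_rep, mk_rep])
  zero_smul x := by
    ext n
    rw [smul_term, smul_term_congr x n (b := 0) (by rw [mk_rep, map_zero, map_zero]), zero_smul,
      term_zero']

/-- The endomorphism of the Tate module induced by an endomorphism of the module, term by term. -/
def map (g : M →ₗ[A] M) : TateModule l M →ₗ[AdicCompletion (Ideal.span {l}) A] TateModule l M where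
  toFun x := ⟨fun n => g (x.term n), by
    constructor
    · have h : x.term 0 = 0 := x.2.1
      simp [h]
    · intro n
      rw [← map_smul, smul_term_succ]⟩
  map_add' x y := by
    ext n
    exact map_add g _ _
  map_smul' a x := by
    ext n
    exact map_smul g _ _

end TateModule

end Tate

/-! ### Reduction modulo `f` and the characteristic polynomial of Frobenius -/

section Reduction

variable {Fq : Type*} [Field Fq] [Fintype Fq]

instance (f : Fq[X]) : Algebra Fq[X] (AdjoinRoot f) := (AdjoinRoot.mk f).toAlgebra

/-- An algebraic closure of the residue field `𝔽_f = A/(f)`. -/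
abbrev ResidueClosure (f : Fq[X]) [Fact (Irreducible f)] : Type _ := AlgebraicClosure (AdjoinRoot f)

/-- The `A`-module `φ̄(L)`, with `φ̄ : A → 𝔽_f[τ]` the reduction of `φ` modulo `f` and `L` an
algebraic closure of `𝔽_f`. Since the coefficients of `φ̄_a` are the images in `𝔽_f` of those of
`φ_a`, this is `φ(L)`, where `L` is an `A`-algebra through `A → 𝔽_f → L`. -/
abbrev DrinfeldModule.ReducedPoints {r : ℕ} (φ : DrinfeldModule Fq r) (f : Fq[X])
    [Fact (Irreducible f)] : Type _ :=
  φ.Points (ResidueClosure f)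

/-- The rank `r_0` of the reduction modulo `f`: the largest `k ≥ 1` such that the coefficient `κ_k`
of `φ_θ` is nonzero modulo `f`, and `0` if there is none. -/
def DrinfeldModule.reducedRank {r : ℕ} (φ : DrinfeldModule Fq r) (f : Fq[X]) : ℕ := by
  classical
  exact ((Finset.Icc 1 r).filter fun k => ¬ f ∣ φ.brac X k).sup id

theorem algebraMap_residueClosure_pow (f : Fq[X]) [Fact (Irreducible f)] (a : Fq[X]) :
    algebraMap Fq[X] (ResidueClosure f) a ^ (Fintype.card Fq ^ f.natDegree) =
      algebraMap Fq[X] (ResidueClosure f) a := by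
  have hf : f ≠ 0 := (Fact.out : Irreducible f).ne_zero
  have h : (AdjoinRoot.mk f a) ^ (Fintype.card Fq ^ f.natDegree) = AdjoinRoot.mk f a := by
    let pb := AdjoinRoot.powerBasis hf
    have : Module.Finite Fq (AdjoinRoot f) := pb.finite
    have : Finite (AdjoinRoot f) := Module.finite_of_finite Fq
    let _ : Fintype (AdjoinRoot f) := Fintype.ofFinite _
    have hc : Fintype.card (AdjoinRoot f) = Fintype.card Fq ^ f.natDegree := by
      rw [Module.card_eq_pow_finrank (K := Fq), pb.finrank, AdjoinRoot.powerBasis_dim]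
    rw [← hc, FiniteField.pow_card]
  rw [IsScalarTower.algebraMap_apply Fq[X] (AdjoinRoot f) (ResidueClosure f), ← map_pow]
  exact congrArg _ h

/-- The `q ^ d`-th power Frobenius `τ ^ d`, with `d = deg f`, as an endomorphism of the
`A`-module of points of the reduction of `φ` modulo `f`. -/
def DrinfeldModule.frobPoints {r : ℕ} (φ : DrinfeldModule Fq r) (f : Fq[X])
    [Fact (Irreducible f)] : φ.ReducedPoints f →ₗ[Fq[X]] φ.ReducedPoints f where
  toFun x := φ.toPoints _ ((φ.toPoints _).symm x ^ (Fintype.card Fq ^ f.natDegree))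
  map_add' x y := by
    rw [map_add, ← map_add (φ.toPoints (ResidueClosure f)), ← frob_pow_apply, ← frob_pow_apply,
      ← frob_pow_apply, map_add]
  map_smul' a x := by
    obtain ⟨x, rfl⟩ := (φ.toPoints (ResidueClosure f)).surjective x
    rw [RingHom.id_apply, DrinfeldModule.smul_toPoints, AddEquiv.symm_apply_apply,
      AddEquiv.symm_apply_apply, DrinfeldModule.smul_toPoints, ← frob_pow_apply, map_sum]
    refine congrArg _ (Finset.sum_congr rfl fun k _ => ?_)
    rw [frob_pow_apply, mul_pow, algebraMap_residueClosure_pow, ← pow_mul, ← pow_mul, mul_comm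
      (Fintype.card Fq ^ k)]

/-- The polynomial `P ∈ A[x]` is the characteristic polynomial of `τ ^ d` acting on the Tate module
`T_l` of the reduction of `φ` modulo `f`, a finite free module over the completion `A_l`. -/
def DrinfeldModule.IsFrobeniusCharpoly {r : ℕ} (φ : DrinfeldModule Fq r) (f : Fq[X])
    [Fact (Irreducible f)] (l : Fq[X]) (P : Fq[X][X]) : Prop :=
  ∃ (_ : Module.Free (AdicCompletion (Ideal.span {l}) Fq[X]) (TateModule l (φ.ReducedPoints f)))
    (_ : Module.Finite (AdicCompletion (Ideal.span {l}) Fq[X])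
      (TateModule l (φ.ReducedPoints f))),
    (TateModule.map (l := l) (φ.frobPoints f)).charpoly =
      P.map (algebraMap Fq[X] (AdicCompletion (Ideal.span {l}) Fq[X]))

/-- `P = P_f` and `c = c_f`: the polynomial `P ∈ A[x]` is monic of degree the rank `r_0` of the
reduction of `φ` modulo `f`; if `r_0 = 0` then `P = 1`; if `r_0 ≥ 1` then, for every monic
irreducible `l ≠ f`, it is the characteristic polynomial of `τ ^ d` on the Tate module `T_l` of the
reduction, and its constant term is `c⁻¹ f`. -/
structure DrinfeldModule.IsFrobeniusPolynomial {r : ℕ} (φ : DrinfeldModule Fq r) (f : Fq[X])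
    [Fact (Irreducible f)] (P : Fq[X][X]) (c : Fqˣ) : Prop where
  monic : P.Monic
  natDegree_eq : P.natDegree = φ.reducedRank f
  eq_one : φ.reducedRank f = 0 → P = 1
  isFrobeniusCharpoly : 1 ≤ φ.reducedRank f →
    ∀ l : Fq[X], l.Monic → Irreducible l → l ≠ f → φ.IsFrobeniusCharpoly f l P
  coeff_zero : 1 ≤ φ.reducedRank f → P.coeff 0 = C ((c⁻¹ : Fqˣ) : Fq) * f

/-- The elements `b_ℓ ∈ A`, for `ℓ ≥ 1`, attached to `P_f = x ^ r_0 + a_{r_0-1} x ^ (r_0-1) + ⋯ +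
a_0` and `c_f`: `b_ℓ = -c_f a_ℓ` if `ℓ < r_0`, `b_ℓ = -c_f` if `ℓ = r_0`, and `b_ℓ = 0` if
`ℓ > r_0`. -/
def DrinfeldModule.b {r : ℕ} (φ : DrinfeldModule Fq r) (f : Fq[X]) (P : Fq[X][X]) (c : Fqˣ)
    (ℓ : ℕ) : Fq[X] :=
  if ℓ < φ.reducedRank f then -(C (c : Fq) * P.coeff ℓ)
  else if ℓ = φ.reducedRank f then -C (c : Fq)
  else 0

/-- The local ring `A_(f)` of `f`-integral elements of the fraction field of `A`. -/
abbrev LocalRing (f : Fq[X]) [Fact (Irreducible f)] : Type _ :=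
  Localization.AtPrime (Ideal.span {f})

end Reduction

end Drinfeld

end

/-! Let `L` be an algebraic closure of `𝔽_f`, `d = deg f` and `s = r_0`. If `s = 0`, the reduction
sends `a` to the constant `a`, hence `f` to `0`. If `s ≥ 1`, Cayley–Hamilton on `T_l` shows that `∑
φ_{a_i} τ^(di)` kills every `l`-power torsion point of `φ(L)`. There are infinitely many of them and
the operator is a polynomial map, so it vanishes modulo `f` (`linearized_frobenius_eq_zero`).
Multiplied by `c_f`, this reads `φ_f ≡ ∑ φ_{b_ℓ} τ^(ℓd)`. Its coefficient at `τ^k` is (b), and for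
`k < d` the sum is empty, which is (a).

For (c), part (a) for the Carlitz module, together with the degree and leading coefficient of `C_f`,
gives `C_f ≡ τ^d` modulo `f`. So `f^ℓ ⋆` substitutes `x^(q^(dℓ))`, which over `𝔽_f` is the same as
raising to the power `q^(dℓ)`. Every term becomes a multiple of `P^(q^k)`, and (c) reduces to (b).

The long part is the existence of a `P_f` common to all `l`. On `L[τ]`, free of rank `s` over `L[t]`
with `t` acting as right multiplication by `φ_θ`, let `Φ` be the matrix of `τ` and `Θ = Φ^(d-1) ⋯
Φ^(1) Φ` that of `τ^d`, where `(i)` raises coefficients to the power `q^i`. From `Θ^(1) Φ = Φ Θ` the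
characteristic polynomial of `Θ` is Frobenius-invariant, so it has coefficients in `Fq[t]`; this is
`P_f`. Its constant term is `± det Θ`, of degree `d` and vanishing at `t = θ`, hence a constant
times `f`.

To compare with `T_l`, a point `x` of `φ[a]` is given a generating polynomial in `L[t]`. Modulo `a`
this is `A`-linear in `x`, and `Φ` acts on the vector of its twists as a Frobenius twist. For a
basis of `T_l` at level `l^n` the resulting square matrix `Ω` satisfies `Θ Ω ≡ Ω M` modulo `l^n`,
with `M` the matrix of `τ^d` on `T_l`. Since `det Ω` is prime to `l` (`isCoprime_det_genVec`), the
characteristic polynomials of `Θ` and `M` agree modulo every `l^n`.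

Elements of `A` enter `L` through `algebraMap`, with `θ` sent to its residue, and enter `L[t]`
through `Polynomial.map`, with `θ` replaced by `t`. -/

noncomputable section

set_option linter.unusedSectionVars false

open Polynomial

namespace Drinfeld

/-! ### Twisted polynomials as `q`-polynomials over a field -/

section LinearizedPolynomials

variable {Fq : Type*} [Field Fq] [Fintype Fq]
  (L : Type*) [Field L] [Algebra Fq L] [Algebra Fq[X] L]

/-- The `q`-polynomial `∑_k c_k x ^ (q ^ k)` over `L` attached to `∑_k c_k τ ^ k ∈ A[τ]`. -/
def linearized (u : TwistedPoly Fq) : L[X] :=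
  ∑ k ∈ SkewPolynomial.support u,
    C (algebraMap Fq[X] L (SkewPolynomial.coeff u k)) * X ^ (Fintype.card Fq ^ k)

theorem eval_linearized (u : TwistedPoly Fq) (x : L) :
    (linearized L u).eval x = twistedAction L u x := by
  simp [linearized, twistedAction_apply, eval_finsetSum]

variable (Fq) in
theorem card_pow_injective : Function.Injective fun k : ℕ => Fintype.card Fq ^ k :=
  Nat.pow_right_injective Fintype.one_lt_card

theorem coeff_linearized (u : TwistedPoly Fq) (k : ℕ) :
    (linearized L u).coeff (Fintype.card Fq ^ k) =
      algebraMap Fq[X] L (SkewPolynomial.coeff u k) := by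
  rw [linearized, finsetSum_coeff, Finset.sum_eq_single k]
  · simp
  · intro j _ hj
    rw [coeff_C_mul, coeff_X_pow, if_neg fun h => hj (card_pow_injective Fq h).symm, mul_zero]
  · intro hk
    rw [SkewPolynomial.notMem_support_iff] at hk
    simp [hk]

/-- The ring homomorphism `A → End(L)` giving the `A`-module structure of `φ(L)`. -/
def DrinfeldModule.act {r : ℕ} (φ : DrinfeldModule Fq r) : Fq[X] →+* AddMonoid.End L :=
  (twistedAction L).comp φ.toAlgHom.toRingHom

variable {r : ℕ} (φ : DrinfeldModule Fq r)

theorem DrinfeldModule.act_apply (a : Fq[X]) (x : L) :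
    φ.act L a x = twistedAction L (φ.toAlgHom a) x := rfl

theorem DrinfeldModule.smul_eq_act (a : Fq[X]) (x : L) :
    a • φ.toPoints L x = φ.toPoints L (φ.act L a x) := rfl

theorem DrinfeldModule.act_mul (a b : Fq[X]) (x : L) :
    φ.act L (a * b) x = φ.act L a (φ.act L b x) := by
  rw [map_mul]; rfl

theorem DrinfeldModule.act_add (a b : Fq[X]) (x : L) :
    φ.act L (a + b) x = φ.act L a x + φ.act L b x := by
  rw [map_add]; rfl

theorem twistedAction_mul (u v : TwistedPoly Fq) (x : L) :
    twistedAction L (u * v) x = twistedAction L u (twistedAction L v x) := by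
  rw [map_mul]; rfl

theorem twistedAction_add (u v : TwistedPoly Fq) (x : L) :
    twistedAction L (u + v) x = twistedAction L u x + twistedAction L v x := by
  rw [map_add]; rfl

/-- Both sides define the same function on `L`, and `L` is infinite. -/
theorem linearized_mul [Infinite L] (u v : TwistedPoly Fq) :
    linearized L (u * v) = (linearized L u).comp (linearized L v) :=
  Polynomial.funext fun x => by
    simp only [eval_comp, eval_linearized, twistedAction_mul]

theorem linearized_add [Infinite L] (u v : TwistedPoly Fq) :
    linearized L (u + v) = linearized L u + linearized L v :=
  Polynomial.funext fun x => by
    simp only [eval_add, eval_linearized, twistedAction_add]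

theorem twistedAction_monomial (k : ℕ) (c : Fq[X]) (x : L) :
    twistedAction L (SkewPolynomial.monomial k c) x =
      algebraMap Fq[X] L c * x ^ (Fintype.card Fq ^ k) := by
  have h : twistedAction L (SkewPolynomial.monomial k c) =
      Module.toAddMonoidEnd Fq[X] L c * frob Fq L ^ k :=
    SkewMonoidAlgebra.liftNC_single _ _ _ _
  rw [h, endMul_apply, frob_pow_apply, ← Algebra.smul_def]
  rfl

theorem DrinfeldModule.toAlgHom_C (c : Fq) :
    φ.toAlgHom (C c) = SkewPolynomial.monomial 0 (C c) := by
  rw [← Polynomial.algebraMap_eq, AlgHom.commutes, Algebra.algebraMap_eq_smul_one,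
    ← SkewPolynomial.monomial_zero_one, Algebra.algebraMap_eq_smul_one]
  exact SkewMonoidAlgebra.smul_single _ _ _

theorem DrinfeldModule.act_C [IsScalarTower Fq Fq[X] L] (c : Fq) (x : L) :
    φ.act L (C c) x = algebraMap Fq L c * x := by
  rw [act_apply, toAlgHom_C, twistedAction_monomial, pow_zero, pow_one, ← Polynomial.algebraMap_eq,
    ← IsScalarTower.algebraMap_apply]

theorem DrinfeldModule.act_X (s : ℕ) (hs : ∀ k, s < k → algebraMap Fq[X] L (φ.brac X k) = 0)
    (x : L) : φ.act L X x =
      ∑ k ∈ Finset.range (s + 1), algebraMap Fq[X] L (φ.brac X k) * x ^ (Fintype.card Fq ^ k) := by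
  rw [act_apply, twistedAction_apply]
  -- The support and `range (s + 1)` are both enlarged to their union; the added terms vanish in
  -- `L`.
  have key : ∀ t : Finset ℕ, SkewPolynomial.support (φ.toAlgHom X) ∪ Finset.range (s + 1) = t →
      ∑ k ∈ SkewPolynomial.support (φ.toAlgHom X),
        algebraMap Fq[X] L (SkewPolynomial.coeff (φ.toAlgHom X) k) * x ^ (Fintype.card Fq ^ k) =
      ∑ k ∈ t,
        algebraMap Fq[X] L (SkewPolynomial.coeff (φ.toAlgHom X) k) * x ^ (Fintype.card Fq ^ k) := by
    rintro t rfl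
    refine Finset.sum_subset Finset.subset_union_left fun k _ hk => ?_
    rw [SkewPolynomial.notMem_support_iff] at hk
    rw [hk, map_zero, zero_mul]
  rw [key _ rfl]
  symm
  refine Finset.sum_subset Finset.subset_union_right fun k _ hk => ?_
  rw [Finset.mem_range, not_lt] at hk
  rw [hs k hk, zero_mul]

/-- If the reduction of `φ_θ` has degree `s` in `τ`, the linearized polynomial of `φ_θ` has degree
`q ^ s`. -/
theorem DrinfeldModule.linearized_X [Infinite L] (s : ℕ)
    (hs : ∀ k, s < k → algebraMap Fq[X] L (φ.brac X k) = 0) :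
    linearized L (φ.toAlgHom X) = ∑ k ∈ Finset.range (s + 1),
      C (algebraMap Fq[X] L (φ.brac X k)) * X ^ (Fintype.card Fq ^ k) :=
  Polynomial.funext fun x => by
    rw [eval_linearized, ← act_apply, φ.act_X L s hs]
    simp [eval_finsetSum]

theorem DrinfeldModule.natDegree_linearized_X [Infinite L] (s : ℕ)
    (hs : ∀ k, s < k → algebraMap Fq[X] L (φ.brac X k) = 0)
    (hs' : algebraMap Fq[X] L (φ.brac X s) ≠ 0) :
    (linearized L (φ.toAlgHom X)).natDegree = Fintype.card Fq ^ s := by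
  apply le_antisymm
  · rw [φ.linearized_X (L := L) s hs]
    refine natDegree_sum_le_of_forall_le _ _ fun k hk => (natDegree_C_mul_X_pow_le _ _).trans ?_
    exact Nat.pow_le_pow_right Fintype.card_pos (Nat.lt_succ_iff.mp (Finset.mem_range.mp hk))
  · exact le_natDegree_of_ne_zero (by rwa [coeff_linearized])

theorem DrinfeldModule.linearized_C [Infinite L] [IsScalarTower Fq Fq[X] L] (c : Fq) :
    linearized L (φ.toAlgHom (C c)) = C (algebraMap Fq L c) * X :=
  Polynomial.funext fun x => by
    rw [eval_linearized, ← act_apply, act_C, eval_mul, eval_C, eval_X]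

/-- Horner's rule `a = divX a * X + a(0)`, the recursion for induction on the degree. -/
theorem DrinfeldModule.linearized_divX [Infinite L] [IsScalarTower Fq Fq[X] L] (a : Fq[X]) :
    linearized L (φ.toAlgHom a) =
      (linearized L (φ.toAlgHom a.divX)).comp (linearized L (φ.toAlgHom X)) +
        C (algebraMap Fq L (a.coeff 0)) * X := by
  conv_lhs => rw [← divX_mul_X_add a, map_add, map_mul, linearized_add, linearized_mul,
    φ.linearized_C L]

/-- Each Horner step composes with the polynomial of `φ_θ`, multiplying the degree by `q^s`; as `s ≥
1`, the added linear term is too small to matter. The second clause serves the Carlitz module, whose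
top coefficient is `1`. -/
theorem DrinfeldModule.natDegree_linearized_and_leadingCoeff [Infinite L] [IsScalarTower Fq Fq[X] L]
    (s : ℕ) (hs0 : 1 ≤ s)
    (hs : ∀ k, s < k → algebraMap Fq[X] L (φ.brac X k) = 0)
    (hs' : algebraMap Fq[X] L (φ.brac X s) ≠ 0) (n : ℕ) (a : Fq[X]) (ha : a ≠ 0)
    (hn : a.natDegree = n) :
    (linearized L (φ.toAlgHom a)).natDegree = Fintype.card Fq ^ (s * n) ∧
      (algebraMap Fq[X] L (φ.brac X s) = 1 →
        (linearized L (φ.toAlgHom a)).leadingCoeff = algebraMap Fq L a.leadingCoeff) := by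
  have hX := φ.natDegree_linearized_X (L := L) s hs hs'
  induction n generalizing a with
  | zero =>
    obtain ⟨c, rfl⟩ := natDegree_eq_zero.mp hn
    have hc : algebraMap Fq L c ≠ 0 := by simpa using ha
    rw [φ.linearized_C L]
    exact ⟨by simp [natDegree_C_mul_X _ hc], by simp⟩
  | succ n ih =>
    have hd : a.divX.natDegree = n := by
      rw [natDegree_divX_eq_natDegree_tsub_one, hn, Nat.add_sub_cancel]
    have hd0 : a.divX ≠ 0 := by
      intro h
      rw [divX_eq_zero_iff] at h
      rw [h, natDegree_C] at hn
      omega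
    have hlc : a.divX.leadingCoeff = a.leadingCoeff := by
      rw [leadingCoeff, leadingCoeff, hd, hn, coeff_divX]
    obtain ⟨h1, h2⟩ := ih a.divX hd0 hd
    have hq : 1 < Fintype.card Fq := Fintype.one_lt_card
    have hdeg : ((linearized L (φ.toAlgHom a.divX)).comp
        (linearized L (φ.toAlgHom X))).natDegree = Fintype.card Fq ^ (s * (n + 1)) := by
      rw [natDegree_comp, h1, hX, ← pow_add]
      congr 1
    have hlt : (C (algebraMap Fq L (a.coeff 0)) * X : L[X]).natDegree <
        ((linearized L (φ.toAlgHom a.divX)).comp (linearized L (φ.toAlgHom X))).natDegree := by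
      rw [hdeg]
      refine (natDegree_C_mul_le _ _).trans_lt ?_
      rw [natDegree_X]
      exact Nat.one_lt_pow (by positivity) hq
    rw [φ.linearized_divX L a]
    refine ⟨by rw [natDegree_add_eq_left_of_natDegree_lt hlt, hdeg], fun h => ?_⟩
    rw [leadingCoeff_add_of_degree_lt' (degree_lt_degree hlt), leadingCoeff_comp, h2 h, hlc]
    · have : (linearized L (φ.toAlgHom X)).leadingCoeff = 1 := by
        rw [leadingCoeff, hX, coeff_linearized]; exact h
      rw [this, one_pow, mul_one]
    · rw [hX]; exact pow_ne_zero _ hq.ne_bot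

theorem DrinfeldModule.natDegree_linearized [Infinite L] [IsScalarTower Fq Fq[X] L]
    {s : ℕ} (hs0 : 1 ≤ s)
    (hs : ∀ k, s < k → algebraMap Fq[X] L (φ.brac X k) = 0)
    (hs' : algebraMap Fq[X] L (φ.brac X s) ≠ 0) {a : Fq[X]} (ha : a ≠ 0) :
    (linearized L (φ.toAlgHom a)).natDegree = Fintype.card Fq ^ (s * a.natDegree) :=
  (φ.natDegree_linearized_and_leadingCoeff L s hs0 hs hs' _ a ha rfl).1

theorem cast_card_pow_eq_zero (k : ℕ) (hk : k ≠ 0) : ((Fintype.card Fq ^ k : ℕ) : L) = 0 := by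
  have h : ((Fintype.card Fq : ℕ) : Fq) = 0 := FiniteField.cast_card_eq_zero Fq
  have h' : ((Fintype.card Fq : ℕ) : L) = 0 := by
    rw [← map_natCast (algebraMap Fq L), h, map_zero]
  rw [Nat.cast_pow, h', zero_pow hk]

/-- In characteristic `p` every `x^(q^k)` with `k ≥ 1` has derivative zero. -/
theorem derivative_linearized (u : TwistedPoly Fq) :
    derivative (linearized L u) = C (algebraMap Fq[X] L (SkewPolynomial.coeff u 0)) := by
  rw [linearized, derivative_sum]
  rw [Finset.sum_eq_single 0]
  · simp
  · intro k _ hk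
    rw [derivative_C_mul, derivative_X_pow, cast_card_pow_eq_zero L k hk]
    simp
  · intro h
    rw [SkewPolynomial.notMem_support_iff] at h
    simp [h]

/-- The constant term of `φ_a` is `a`, as seen in an infinite field over `A`. -/
theorem DrinfeldModule.algebraMap_brac_zero [Infinite L] [IsScalarTower Fq Fq[X] L] (a : Fq[X]) :
    algebraMap Fq[X] L (φ.brac a 0) = algebraMap Fq[X] L a := by
  -- The coefficient of `τ^0` is the derivative at `0`, so the chain rule makes it multiplicative.
  have h : ∀ u : TwistedPoly Fq, (derivative (linearized L u)).eval 0 =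
      algebraMap Fq[X] L (SkewPolynomial.coeff u 0) := fun u => by
    rw [derivative_linearized, eval_C]
  rw [brac, ← h]
  induction a using Polynomial.induction_on' with
  | add a b ha hb => rw [map_add, linearized_add, derivative_add, eval_add, ha, hb, map_add]
  | monomial n c =>
    induction n with
    | zero =>
      rw [monomial_zero_left, linearized_C, derivative_C_mul, derivative_X, eval_mul, eval_C,
        eval_one, mul_one, ← Polynomial.algebraMap_eq, ← IsScalarTower.algebraMap_apply]
    | succ n ih =>
      rw [← monomial_mul_X, map_mul, linearized_mul, derivative_comp, eval_mul, eval_comp, h,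
        φ.coeff_zero]
      have h0 : (linearized L (φ.toAlgHom X)).eval 0 = 0 := by
        rw [eval_linearized, map_zero]
      rw [h0, ih, map_mul, mul_comm]

theorem linearized_eq_zero (u : TwistedPoly Fq) (h : linearized L u = 0) (k : ℕ) :
    algebraMap Fq[X] L (SkewPolynomial.coeff u k) = 0 := by
  rw [← coeff_linearized, h, Polynomial.coeff_zero]

end LinearizedPolynomials

/-! ### Divisibility and torsion of `φ(L)` -/

section Torsion

variable {Fq : Type*} [Field Fq] [Fintype Fq]
  (L : Type*) [Field L] [IsAlgClosed L] [Algebra Fq L] [Algebra Fq[X] L] [IsScalarTower Fq Fq[X] L]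
  {r : ℕ} (φ : DrinfeldModule Fq r)

theorem DrinfeldModule.act_surjective {s : ℕ} (hs0 : 1 ≤ s)
    (hs : ∀ k, s < k → algebraMap Fq[X] L (φ.brac X k) = 0)
    (hs' : algebraMap Fq[X] L (φ.brac X s) ≠ 0)
    {a : Fq[X]} (ha : a ≠ 0) (y : L) :
    ∃ x, φ.act L a x = y := by
  have hd := φ.natDegree_linearized L hs0 hs hs' ha
  obtain ⟨x, hx⟩ := IsAlgClosed.exists_root (linearized L (φ.toAlgHom a) - C y) (by
    apply ne_of_gt
    rw [← natDegree_pos_iff_degree_pos, natDegree_sub_C, hd]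
    exact Nat.pow_pos Fintype.card_pos)
  refine ⟨x, ?_⟩
  rw [act_apply, ← eval_linearized]
  simpa [sub_eq_zero] using hx

/-- The derivative of the polynomial of `φ_a` is the nonzero constant `a`, so its `q^(s deg a)`
roots are distinct. -/
theorem DrinfeldModule.card_torsion {s : ℕ} (hs0 : 1 ≤ s)
    (hs : ∀ k, s < k → algebraMap Fq[X] L (φ.brac X k) = 0)
    (hs' : algebraMap Fq[X] L (φ.brac X s) ≠ 0)
    {a : Fq[X]} (ha : algebraMap Fq[X] L a ≠ 0) :
    Nat.card {x : L // φ.act L a x = 0} = Fintype.card Fq ^ (s * a.natDegree) := by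
  have ha0 : a ≠ 0 := by rintro rfl; simp at ha
  have hd := φ.natDegree_linearized L hs0 hs hs' ha0
  have hp0 : linearized L (φ.toAlgHom a) ≠ 0 := by
    intro h; rw [h, natDegree_zero] at hd
    exact (Nat.pow_pos Fintype.card_pos).ne hd
  have hsep : (linearized L (φ.toAlgHom a)).Separable := by
    rw [separable_def, derivative_linearized]
    have h : algebraMap Fq[X] L (SkewPolynomial.coeff (φ.toAlgHom a) 0) = algebraMap Fq[X] L a :=
      φ.algebraMap_brac_zero L a
    rw [h]
    obtain ⟨v, hv⟩ := (isUnit_C.mpr ha.isUnit).exists_left_inv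
    exact ⟨0, v, by rw [hv]; simp⟩
  rw [← hd, ← card_rootSet_eq_natDegree (K := L) hsep (IsAlgClosed.splits _),
    ← Nat.card_eq_fintype_card]
  refine Nat.card_congr (Equiv.subtypeEquivRight fun x => ?_)
  rw [mem_rootSet_of_ne hp0, coe_aeval_eq_eval, eval_linearized, act_apply]

end Torsion

/-! ### Bases of Tate modules -/

namespace TateModule

variable {A : Type*} [CommRing A] {l : A} {M : Type*} [AddCommGroup M] [Module A M]

/-- Every point killed by `l ^ n` is a term of an element of the Tate module, if the module is
divisible by `l`. -/
theorem exists_term_eq (hdiv : ∀ x : M, ∃ y, l • y = x) (n : ℕ) (x : M) (hx : l ^ n • x = 0) :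
    ∃ t : TateModule l M, t.term n = x := by
  choose g hg using hdiv
  have hs : ∀ m, l • (g^[m + 1] x) = g^[m] x := fun m => by
    rw [Function.iterate_succ_apply', hg]
  have hs' : ∀ m, l ^ m • (g^[m] x) = x := fun m => by
    induction m with
    | zero => simp
    | succ m ih => rw [pow_succ, mul_smul, hs, ih]
  -- With `g` a section of multiplication by `l`, the sequence `l^n g^m(x)` starts at `l^n x = 0`
  -- and equals `x` at `m = n`.
  exact ⟨⟨fun m => l ^ n • g^[m] x, hx, fun m => by rw [smul_comm, hs]⟩, hs' n⟩

/-- Division by `l` is the shift of the sequence, and the shift must again start at `0`. -/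
theorem exists_smul_eq (t : TateModule l M) (h : t.term 1 = 0) :
    ∃ t' : TateModule l M, ∀ n, l • t'.term n = t.term n :=
  ⟨⟨fun n => t.term (n + 1), h, fun n => t.smul_term_succ (n + 1)⟩, fun n => t.smul_term_succ n⟩

theorem term_sum {ι : Type*} (s : Finset ι) (t : ι → TateModule l M) (n : ℕ) :
    (∑ i ∈ s, t i).term n = ∑ i ∈ s, (t i).term n := by
  classical
  induction s using Finset.induction_on with
  | empty => rfl
  | insert i s hi ih => rw [Finset.sum_insert hi, Finset.sum_insert hi, term_add, ih]

theorem algebraMap_smul_term (a : A) (t : TateModule l M) (n : ℕ) :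
    (algebraMap A (AdicCompletion (Ideal.span {l}) A) a • t).term n = a • t.term n := by
  rw [smul_term]
  refine smul_term_congr t n ?_
  rw [mk_rep]
  exact AlgHom.commutes (AdicCompletion.evalₐ (Ideal.span {l}) n) a

variable {ι : Type*} [Fintype ι]

/-- If the first terms of `e` are independent modulo `l`, the `n`-th terms are independent modulo
`l ^ n`. -/
theorem pow_dvd_of_sum_smul_term_eq_zero (e : ι → TateModule l M)
    (hind : ∀ a : ι → A, ∑ i, a i • (e i).term 1 = 0 → ∀ i, l ∣ a i) (n : ℕ) (a : ι → A)
    (h : ∑ i, a i • (e i).term n = 0) (i : ι) : l ^ n ∣ a i := by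
  induction n generalizing a with
  | zero => simp
  | succ n ih =>
    have h1 : ∀ i, l ∣ a i := by
      apply hind
      -- Multiplication by `l^n` brings the relation down to first terms, whose independence makes
      -- each `a i` a multiple of `l`.
      have hterm : ∀ i, l ^ n • (e i).term (n + 1) = (e i).term 1 := fun i => by
        clear ih h
        induction n with
        | zero => simp
        | succ n ih => rw [pow_succ, mul_smul, smul_term_succ, ih]
      have h' := congrArg (l ^ n • ·) h
      simp only [Finset.smul_sum, smul_zero, smul_comm (l ^ n), hterm] at h'
      exact h'
    choose b hb using h1
    have h2 : ∑ i, b i • (e i).term n = 0 := by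
      rw [← h]
      refine Finset.sum_congr rfl fun i _ => ?_
      rw [hb i, mul_comm, mul_smul, smul_term_succ]
    rw [hb i, pow_succ']
    exact mul_dvd_mul_left l (ih b h2)

/-- If the first terms of `e` generate the `l`-torsion, the `n`-th terms generate all `n`-th terms
of elements of the Tate module. -/
theorem exists_sum_smul_term_eq (e : ι → TateModule l M)
    (hspan : ∀ x : M, l • x = 0 → ∃ a : ι → A, ∑ i, a i • (e i).term 1 = x) (n : ℕ)
    (t : TateModule l M) : ∃ a : ι → A, ∑ i, a i • (e i).term n = t.term n := by
  induction n generalizing t with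
  | zero =>
    refine ⟨0, ?_⟩
    have h : t.term 0 = 0 := t.2.1
    simp [h]
  | succ n ih =>
    obtain ⟨a, ha⟩ := hspan (t.term 1) (by simpa using t.pow_smul_term 1)
    -- Subtracting a combination of the `e i` kills the first term of `t`; the difference is then `l
    -- t'`, and induction applies to `t'`.
    have hsub : ∀ m, (t + ∑ i, algebraMap A (AdicCompletion (Ideal.span {l}) A) (-a i) • e i).term m = t.term m - ∑ i, a i • (e i).term m := by
      intro m
      rw [term_add, term_sum, sub_eq_add_neg, ← Finset.sum_neg_distrib]
      simp only [algebraMap_smul_term, neg_smul]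
    obtain ⟨t', ht'⟩ := exists_smul_eq (t + ∑ i, algebraMap A (AdicCompletion (Ideal.span {l}) A) (-a i) • e i) (by rw [hsub, ha, sub_self])
    obtain ⟨b, hb⟩ := ih t'
    refine ⟨fun i => a i + l * b i, ?_⟩
    have h3 : ∑ i, (l * b i) • (e i).term (n + 1) = t'.term n := by
      rw [← hb]
      refine Finset.sum_congr rfl fun i _ => ?_
      rw [mul_comm, mul_smul, smul_term_succ]
    simp only [add_smul, Finset.sum_add_distrib, h3]
    have h4 := ht' (n + 1)
    rw [smul_term_succ, hsub] at h4
    rw [h4]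
    abel

/-- Elements of the Tate module whose first terms are a basis of the `l`-torsion over `A/l` are a
basis of the Tate module over the completion. -/
theorem exists_basis (e : ι → TateModule l M)
    (hind : ∀ a : ι → A, ∑ i, a i • (e i).term 1 = 0 → ∀ i, l ∣ a i)
    (hspan : ∀ x : M, l • x = 0 → ∃ a : ι → A, ∑ i, a i • (e i).term 1 = x) :
    ∃ b : Module.Basis ι (AdicCompletion (Ideal.span {l}) A) (TateModule l M), ⇑b = e := by
  have hli : LinearIndependent (AdicCompletion (Ideal.span {l}) A) e := by
    rw [Fintype.linearIndependent_iff]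
    intro g hg i
    refine AdicCompletion.ext_evalₐ (I := Ideal.span {l}) fun n => ?_
    rw [map_zero, ← mk_rep, Ideal.Quotient.eq_zero_iff_mem, Ideal.span_singleton_pow,
      Ideal.mem_span_singleton]
    refine pow_dvd_of_sum_smul_term_eq_zero e hind n (fun i => rep n (g i)) ?_ i
    have h := congrArg (fun t => term t n) hg
    simpa only [term_sum, smul_term, term_zero'] using h
  have hsp : ⊤ ≤ Submodule.span (AdicCompletion (Ideal.span {l}) A) (Set.range e) := by
    intro t _
    choose a ha using fun n => exists_sum_smul_term_eq e hspan n t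
    -- Coefficients at level `n` are unique modulo `l^n`, so any choice of them is compatible and
    -- converges in `A_l`.
    have hcau : ∀ i n, l ^ n ∣ a (n + 1) i - a n i := by
      intro i n
      refine pow_dvd_of_sum_smul_term_eq_zero e hind n (fun i => a (n + 1) i - a n i) ?_ i
      simp only [sub_smul, Finset.sum_sub_distrib, ha n]
      have h : ∑ i, a (n + 1) i • (e i).term n = l • ∑ i, a (n + 1) i • (e i).term (n + 1) := by
        rw [Finset.smul_sum]
        refine Finset.sum_congr rfl fun i _ => ?_
        rw [smul_comm, smul_term_succ]
      rw [h, ha, smul_term_succ, sub_self]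
    let α : ι → AdicCompletion (Ideal.span {l}) A := fun i =>
      AdicCompletion.mk (Ideal.span {l}) A (AdicCompletion.AdicCauchySequence.mk _ _
        (fun n => a n i) (fun n => by
          rw [SModEq.comm, SModEq.sub_mem, smul_eq_mul, Ideal.mul_top, Ideal.span_singleton_pow,
            Ideal.mem_span_singleton]
          exact hcau i n))
    have hα : ∑ i, α i • e i = t := by
      ext n
      rw [term_sum, ← ha n]
      refine Finset.sum_congr rfl fun i _ => ?_
      rw [smul_term]
      refine smul_term_congr _ n ?_
      rw [mk_rep, AdicCompletion.evalₐ_mk]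
      rfl
    rw [← hα]
    exact Submodule.sum_mem _ fun i _ => Submodule.smul_mem _ _ (Submodule.subset_span ⟨i, rfl⟩)
  exact ⟨Module.Basis.mk hli hsp, Module.Basis.coe_mk hli hsp⟩

/-- If `M` is divisible by `l` with `A/l` a finite field and `M[l]` has `#(A/l) ^ s` elements, the
Tate module has a basis of `s` elements over the completion, whose `n`-th terms generate
`M[l ^ n]`. -/
theorem exists_basis_of_card [(Ideal.span {l}).IsMaximal]
    [Finite (A ⧸ Ideal.span {l})] (hdiv : ∀ x : M, ∃ y, l • y = x) (s : ℕ)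
    (hcard : Nat.card {x : M // l • x = 0} = Nat.card (A ⧸ Ideal.span {l}) ^ s) :
    ∃ b : Module.Basis (Fin s) (AdicCompletion (Ideal.span {l}) A) (TateModule l M),
      ∀ (n : ℕ) (x : M), l ^ n • x = 0 → ∃ a : Fin s → A, ∑ i, a i • (b i).term n = x := by
  let _ : Field (A ⧸ Ideal.span {l}) := Ideal.Quotient.field _
  let T := Submodule.torsionBy A M l
  let e : T ≃ {x : M // l • x = 0} := Equiv.subtypeEquivRight fun x =>
    Submodule.mem_torsionBy_iff l x
  have hq : 1 < Nat.card (A ⧸ Ideal.span {l}) := Finite.one_lt_card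
  have : Finite {x : M // l • x = 0} := Nat.finite_of_card_ne_zero (by
    rw [hcard]; exact pow_ne_zero _ hq.ne_bot)
  have : Finite T := Finite.of_equiv _ e.symm
  -- `M[l]` is a vector space over the finite field `A/l`, so its cardinality determines its
  -- dimension.
  have hrank : Module.finrank (A ⧸ Ideal.span {l}) T = s := by
    have h := Module.natCard_eq_pow_finrank (K := A ⧸ Ideal.span {l}) (V := T)
    rw [Nat.card_congr e, hcard] at h
    exact (Nat.pow_right_injective hq h).symm
  let B := Module.finBasisOfFinrankEq (A ⧸ Ideal.span {l}) T hrank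
  have hsmul : ∀ (a : A) (x : T), (Ideal.Quotient.mk (Ideal.span {l}) a) • x = a • x :=
    fun a x => rfl
  choose t ht using fun i => exists_term_eq hdiv 1 (B i : M) (by
    rw [pow_one]; exact (Submodule.mem_torsionBy_iff l _).mp (B i).2)
  have hsum : ∀ a : Fin s → A, ∑ i, a i • (t i).term 1 =
      ((∑ i, Ideal.Quotient.mk (Ideal.span {l}) (a i) • B i : T) : M) := by
    intro a
    rw [Submodule.coe_sum]
    refine Finset.sum_congr rfl fun i _ => ?_
    rw [ht, hsmul]
    rfl
  have hspan : ∀ x : M, l • x = 0 → ∃ a : Fin s → A, ∑ i, a i • (t i).term 1 = x := by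
    intro x hx
    let x' : T := ⟨x, (Submodule.mem_torsionBy_iff l x).mpr hx⟩
    choose a ha using fun i => Ideal.Quotient.mk_surjective (B.repr x' i)
    refine ⟨a, ?_⟩
    rw [hsum]
    simp only [ha, B.sum_repr]
    rfl
  obtain ⟨b, hb⟩ := exists_basis t (fun a ha i => by
    rw [hsum] at ha
    have h := Fintype.linearIndependent_iff.mp B.linearIndependent _ (Subtype.ext ha) i
    rwa [Ideal.Quotient.eq_zero_iff_mem, Ideal.mem_span_singleton] at h) hspan
  refine ⟨b, fun n x hx => ?_⟩
  obtain ⟨u, rfl⟩ := exists_term_eq hdiv n x hx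
  rw [hb]
  exact exists_sum_smul_term_eq t hspan n u

end TateModule

/-! ### Frobenius twists of polynomials and descent to `Fq` -/

section Twist

variable (Fq : Type*) [Field Fq] [Fintype Fq] {L : Type*} [Field L] [Algebra Fq L]

/-- The `q ^ i`-th power Frobenius of `L`. -/
def frobPow (i : ℕ) : L →ₐ[Fq] L := FiniteField.frobeniusAlgHom Fq L ^ i

theorem frobPow_apply (i : ℕ) (x : L) : frobPow Fq i x = x ^ (Fintype.card Fq ^ i) := by
  rw [frobPow, AlgHom.coe_pow, FiniteField.coe_frobeniusAlgHom, pow_iterate]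

/-- The twist of a polynomial over `L`: its coefficients are raised to the power `q ^ i`. -/
def twist (i : ℕ) : L[X] →+* L[X] := mapRingHom (frobPow Fq i : L →ₐ[Fq] L).toRingHom

theorem coeff_twist (i : ℕ) (p : L[X]) (m : ℕ) :
    (twist Fq i p).coeff m = p.coeff m ^ (Fintype.card Fq ^ i) := by
  rw [twist, coe_mapRingHom, coeff_map]
  exact frobPow_apply Fq i _

theorem twist_zero (p : L[X]) : twist Fq 0 p = p := by
  ext m; rw [coeff_twist, pow_zero, pow_one]

theorem twist_twist (i j : ℕ) (p : L[X]) : twist Fq i (twist Fq j p) = twist Fq (i + j) p := by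
  ext m; rw [coeff_twist, coeff_twist, coeff_twist, ← pow_mul, ← pow_add, add_comm]

theorem twist_C (i : ℕ) (c : L) : twist Fq i (C c) = C (c ^ (Fintype.card Fq ^ i)) := by
  rw [twist, coe_mapRingHom, map_C]
  exact congrArg C (frobPow_apply Fq i c)

theorem twist_X (i : ℕ) : twist Fq i (X : L[X]) = X := by
  rw [twist, coe_mapRingHom, map_X]

theorem twist_map (i : ℕ) (a : Fq[X]) :
    twist Fq i (a.map (algebraMap Fq L)) = a.map (algebraMap Fq L) := by
  rw [twist, coe_mapRingHom, Polynomial.map_map]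
  congr 1
  exact (frobPow Fq i : L →ₐ[Fq] L).comp_algebraMap

theorem natDegree_twist (i : ℕ) (p : L[X]) : (twist Fq i p).natDegree = p.natDegree := by
  rw [twist, coe_mapRingHom]
  exact natDegree_map _

theorem twist_ne_zero (i : ℕ) {p : L[X]} (hp : p ≠ 0) : twist Fq i p ≠ 0 := by
  rw [twist, coe_mapRingHom]
  exact (Polynomial.map_ne_zero_iff (RingHom.injective _)).mpr hp

/-- The elements of `L` fixed by the `q`-th power Frobenius are those of `Fq`. -/
theorem mem_range_of_pow_card_eq (x : L) (hx : x ^ Fintype.card Fq = x) :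
    x ∈ (algebraMap Fq L).range := by
  classical
  have hq : 1 < Fintype.card Fq := Fintype.one_lt_card
  have h0 : (X ^ Fintype.card Fq - X : L[X]) ≠ 0 := FiniteField.X_pow_card_sub_X_ne_zero L hq
  -- `X^q - X` has at most `q` roots, and the image of `Fq` already supplies `q` of them.
  have hsub : (Finset.univ.image (algebraMap Fq L)) ⊆
      (X ^ Fintype.card Fq - X : L[X]).roots.toFinset := by
    intro y hy
    obtain ⟨c, -, rfl⟩ := Finset.mem_image.mp hy
    rw [Multiset.mem_toFinset, mem_roots h0, IsRoot.def, eval_sub, eval_pow, eval_X, ← map_pow,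
      FiniteField.pow_card, sub_self]
  have hcard : (X ^ Fintype.card Fq - X : L[X]).roots.toFinset.card ≤
      (Finset.univ.image (algebraMap Fq L)).card := by
    rw [Finset.card_image_of_injective _ (algebraMap Fq L).injective, Finset.card_univ]
    refine (Multiset.toFinset_card_le _).trans ((card_roots' _).trans_eq ?_)
    exact FiniteField.X_pow_card_sub_X_natDegree_eq L hq
  have hx' : x ∈ (X ^ Fintype.card Fq - X : L[X]).roots.toFinset := by
    rw [Multiset.mem_toFinset, mem_roots h0, IsRoot.def, eval_sub, eval_pow, eval_X, hx, sub_self]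
  rw [← Finset.eq_of_subset_of_card_le hsub hcard] at hx'
  obtain ⟨c, -, hc⟩ := Finset.mem_image.mp hx'
  exact ⟨c, hc⟩

theorem exists_map_eq_of_twist_eq (p : L[X][X]) (hp : p.map (twist Fq 1) = p) :
    ∃ P : Fq[X][X], P.map (mapRingHom (algebraMap Fq L)) = p := by
  rw [← mem_lifts, lifts_iff_coeff_lifts]
  intro n
  rw [← RingHom.coe_range, SetLike.mem_coe, RingHom.mem_range]
  obtain ⟨c, hc⟩ : p.coeff n ∈ lifts (algebraMap Fq L) := by
    rw [lifts_iff_coeff_lifts]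
    intro m
    refine mem_range_of_pow_card_eq Fq _ ?_
    have h := congrArg (fun u => (u.coeff n).coeff m) hp
    simp only [coeff_map, coeff_twist, pow_one] at h
    exact h
  exact ⟨c, hc⟩

end Twist

/-- `S` also intertwines the characteristic matrices, so after taking determinants `det S` can be
cancelled coefficientwise. Regularity of `det S` suffices, which covers both `Φ` over `L[t]` and `Ω`
over `L[t]/(l^n)`. -/
theorem charpoly_eq_of_mul_eq_mul {R n : Type*} [CommRing R] [Fintype n] [DecidableEq n]
    {M N S : Matrix n n R} (h : M * S = S * N) (hS : IsRegular S.det) :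
    M.charpoly = N.charpoly := by
  have hc : M.charmatrix * S.map C = S.map C * N.charmatrix := by
    have h' : M.map C * S.map C = S.map C * N.map C := by
      rw [← Matrix.map_mul, ← Matrix.map_mul, h]
    simp only [Matrix.charmatrix, sub_mul, mul_sub, RingHom.mapMatrix_apply]
    rw [h', (Matrix.scalar_commute X (fun _ => Commute.all _ _) (S.map C)).eq]
  have hd := congrArg Matrix.det hc
  have hSd : (S.map C).det = C S.det := (RingHom.map_det C S).symm
  rw [Matrix.det_mul, Matrix.det_mul, hSd, mul_comm] at hd
  change C S.det * M.charpoly = C S.det * N.charpoly at hd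
  ext k
  have hk := congrArg (fun p => p.coeff k) hd
  simp only [coeff_C_mul] at hk
  exact hS.left hk

/-! ### Generating polynomials and the matrix of `τ` -/

section GeneratingPolynomial

variable {Fq : Type*} [Field Fq] [Fintype Fq]
  {L : Type*} [Field L] [Algebra Fq L] [Algebra Fq[X] L]
  {r : ℕ} (φ : DrinfeldModule Fq r)

theorem coeff_iterate_divX (a : Fq[X]) (n m : ℕ) : (divX^[n] a).coeff m = a.coeff (m + n) := by
  induction n generalizing m with
  | zero => rfl
  | succ n ih => rw [Function.iterate_succ_apply', coeff_divX, ih, add_right_comm, add_assoc]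

/-- The generating polynomial of a point `x` of `φ(L)`: the polynomial part of
`a(t) ∑_k φ_{θ^k}(x) t ^ (-k-1)`, an element of `L[t]` of degree less than `deg a`. -/
def DrinfeldModule.gen (a : Fq[X]) (x : L) : L[X] :=
  ∑ m ∈ Finset.range a.natDegree, monomial m (φ.act L (divX^[m + 1] a) x)

theorem DrinfeldModule.coeff_gen (a : Fq[X]) (x : L) (m : ℕ) :
    (φ.gen a x).coeff m = φ.act L (divX^[m + 1] a) x := by
  simp only [gen, finsetSum_coeff, coeff_monomial, Finset.sum_ite_eq', Finset.mem_range]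
  split_ifs with h
  · rfl
  · have h0 : divX^[m + 1] a = 0 := by
      ext k
      rw [coeff_iterate_divX, Polynomial.coeff_zero]
      exact coeff_eq_zero_of_natDegree_lt (by omega)
    rw [h0, map_zero]
    rfl

theorem DrinfeldModule.gen_add (a : Fq[X]) (x y : L) :
    φ.gen a (x + y) = φ.gen a x + φ.gen a y := by
  ext m; simp only [coeff_gen, coeff_add, map_add]

theorem DrinfeldModule.gen_sum {ι : Type*} (t : Finset ι) (a : Fq[X]) (x : ι → L) :
    φ.gen a (∑ i ∈ t, x i) = ∑ i ∈ t, φ.gen a (x i) := by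
  ext m; simp only [coeff_gen, finsetSum_coeff, map_sum]

theorem DrinfeldModule.act_act_comm (a b : Fq[X]) (x : L) :
    φ.act L a (φ.act L b x) = φ.act L b (φ.act L a x) := by
  rw [← act_mul, mul_comm, act_mul]

/-- Multiplying `∑ φ_{θ^k}(x) t^(-k-1)` by `t` replaces `x` by `φ_θ(x)` and adds the constant `x`,
whence the term `a(t) x`. The coefficient of `t^(-1)` in `a(t) ∑ φ_{θ^k}(x) t^(-k-1)` is `φ_a(x)`;
it would enter the polynomial part and is removed. -/
theorem DrinfeldModule.X_mul_gen [IsScalarTower Fq Fq[X] L] (a : Fq[X]) (x : L) :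
    X * φ.gen a x = φ.gen a (φ.act L X x) + a.map (algebraMap Fq L) * C x -
      C (φ.act L a x) := by
  have key : ∀ b : Fq[X], φ.act L b x = φ.act L b.divX (φ.act L X x) +
      algebraMap Fq L (b.coeff 0) * x := fun b => by
    conv_lhs => rw [← divX_mul_X_add b, act_add, act_mul, act_C]
  ext m
  rw [coeff_sub, coeff_add, coeff_mul_C, coeff_map, coeff_gen]
  cases m with
  | zero =>
    rw [mul_coeff_zero, coeff_X_zero, zero_mul, coeff_C_zero, key a]
    simp
  | succ m =>
    rw [coeff_X_mul, coeff_gen, coeff_C_succ, sub_zero, key, Function.iterate_succ_apply' _ (m + 1),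
      coeff_iterate_divX, zero_add]

/-- Iterates `X_mul_gen` on `φ[a]`, where the term `φ_a(x)` drops out. This is the `A`-linearity of
`gen` modulo `a`. -/
theorem DrinfeldModule.dvd_gen_act_sub [IsScalarTower Fq Fq[X] L] (a b : Fq[X]) (x : L)
    (hx : φ.act L a x = 0) :
    a.map (algebraMap Fq L) ∣ φ.gen a (φ.act L b x) - b.map (algebraMap Fq L) * φ.gen a x := by
  induction b using Polynomial.induction_on' with
  | add b c hb hc =>
    rw [act_add, gen_add, Polynomial.map_add, add_mul, add_sub_add_comm]
    exact dvd_add hb hc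
  | monomial n c =>
    induction n generalizing x with
    | zero =>
      have h : φ.gen a (φ.act L (C c) x) = C (algebraMap Fq L c) * φ.gen a x := by
        ext m
        rw [coeff_C_mul, coeff_gen, coeff_gen, act_act_comm, act_C]
      rw [monomial_zero_left, h, map_C, sub_self]
      exact dvd_zero _
    | succ n ih =>
      have h := ih (φ.act L X x) (by rw [act_act_comm, hx, map_zero])
      have h1 := φ.X_mul_gen a x
      rw [hx, C_0, sub_zero] at h1
      rw [← monomial_mul_X, act_mul, Polynomial.map_mul, map_X, mul_assoc, h1, mul_add, sub_add_eq_sub_sub]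
      refine dvd_sub h ?_
      rw [mul_left_comm]
      exact dvd_mul_right _ _

/-- The coefficients of `gen` are values `φ_b(x)`, and `φ_b` commutes with `φ_θ`. -/
theorem DrinfeldModule.sum_twist_gen {s : ℕ}
    (hs : ∀ k, s < k → algebraMap Fq[X] L (φ.brac X k) = 0) (a : Fq[X]) (x : L) :
    ∑ k ∈ Finset.range (s + 1), C (algebraMap Fq[X] L (φ.brac X k)) * twist Fq k (φ.gen a x) =
      φ.gen a (φ.act L X x) := by
  ext m
  simp only [finsetSum_coeff, coeff_C_mul, coeff_twist, coeff_gen]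
  rw [act_act_comm, φ.act_X L s hs]

/-- The vector of the first `s` twists of the generating polynomial. -/
def DrinfeldModule.genVec (s : ℕ) (a : Fq[X]) (x : L) : Fin s → L[X] :=
  fun i => twist Fq i (φ.gen a x)

theorem DrinfeldModule.genVec_sum {ι : Type*} (s : ℕ) (t : Finset ι) (a : Fq[X]) (x : ι → L)
    (i : Fin s) : φ.genVec s a (∑ j ∈ t, x j) i = ∑ j ∈ t, φ.genVec s a (x j) i := by
  rw [genVec, gen_sum, map_sum]
  rfl

theorem DrinfeldModule.dvd_genVec_act_sub [IsScalarTower Fq Fq[X] L] (s : ℕ) (a b : Fq[X]) (x : L)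
    (hx : φ.act L a x = 0) (i : Fin s) :
    a.map (algebraMap Fq L) ∣
      φ.genVec s a (φ.act L b x) i - b.map (algebraMap Fq L) * φ.genVec s a x i := by
  have h := map_dvd (twist Fq i) (φ.dvd_gen_act_sub a b x hx)
  rwa [map_sub, map_mul, twist_map, twist_map] at h

variable (L) in
/-- The matrix of multiplication by `τ` on the `L[t]`-module `L[τ]`, on which `t` acts as
multiplication by the reduction of `φ_θ` on the right, in the basis `1, τ, …, τ ^ (s - 1)`. -/
def DrinfeldModule.tauMatrix (s : ℕ) : Matrix (Fin s) (Fin s) L[X] := fun i j =>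
  if (i : ℕ) + 1 = s then C (algebraMap Fq[X] L (φ.brac X s))⁻¹ *
    ((if (j : ℕ) = 0 then X else 0) - C (algebraMap Fq[X] L (φ.brac X j)))
  else if (j : ℕ) = i + 1 then 1 else 0

/-- Writing `G` for `gen a x`, `X_mul_gen` and `sum_twist_gen` give `t G ≡ ∑_{k ≤ s} κ_k G^(k)`
modulo `a`. The last row of the matrix solves this for `G^(s)`; the other rows only shift the
twists. -/
theorem DrinfeldModule.tauMatrix_mulVec [IsScalarTower Fq Fq[X] L] {s : ℕ}
    (hs : ∀ k, s < k → algebraMap Fq[X] L (φ.brac X k) = 0)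
    (hs' : algebraMap Fq[X] L (φ.brac X s) ≠ 0) (a : Fq[X]) (x : L) (hx : φ.act L a x = 0) :
    ∃ w : Fin s → L[X], (φ.tauMatrix L s).mulVec (φ.genVec s a x) =
      twist Fq 1 ∘ φ.genVec s a x + a.map (algebraMap Fq L) • w := by
  have key : ∀ i, ∃ w : L[X], (φ.tauMatrix L s).mulVec (φ.genVec s a x) i =
      twist Fq 1 (φ.genVec s a x i) + a.map (algebraMap Fq L) * w := by
    intro i
    have hi := i.2
    simp only [Matrix.mulVec, dotProduct, tauMatrix, genVec, twist_twist]
    split_ifs with h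
    · have h1 := φ.X_mul_gen a x
      rw [hx, C_0, sub_zero, ← φ.sum_twist_gen hs, Finset.sum_range_succ] at h1
      refine ⟨C (algebraMap Fq[X] L (φ.brac X s))⁻¹ * C x, ?_⟩
      have h2 : ∑ j : Fin s, (if (j : ℕ) = 0 then (X : L[X]) else 0) * twist Fq j (φ.gen a x) =
          X * φ.gen a x := by
        rw [Fin.sum_univ_eq_sum_range
          (fun j => (if j = 0 then (X : L[X]) else 0) * twist Fq j (φ.gen a x)) s,
          Finset.sum_eq_single_of_mem 0 (Finset.mem_range.mpr (by omega)), if_pos rfl, twist_zero]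
        intro j _ hj
        rw [if_neg hj, zero_mul]
      have h3 : ∑ j : Fin s, C (algebraMap Fq[X] L (φ.brac X j)) * twist Fq j (φ.gen a x) =
          ∑ j ∈ Finset.range s, C (algebraMap Fq[X] L (φ.brac X j)) * twist Fq j (φ.gen a x) :=
        Fin.sum_univ_eq_sum_range
          (fun j => C (algebraMap Fq[X] L (φ.brac X j)) * twist Fq j (φ.gen a x)) s
      simp only [mul_assoc, sub_mul, ← Finset.mul_sum, Finset.sum_sub_distrib]
      rw [h2, h3, h1, add_comm 1, h]
      have h4 : C (algebraMap Fq[X] L (φ.brac X s))⁻¹ * C (algebraMap Fq[X] L (φ.brac X s)) =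
          (1 : L[X]) := by
        rw [← C_mul, inv_mul_cancel₀ hs', C_1]
      linear_combination (twist Fq s (φ.gen a x)) * h4
    · refine ⟨0, ?_⟩
      rw [Finset.sum_eq_single (⟨i + 1, by omega⟩ : Fin s)]
      · simp [add_comm]
      · intro j _ hj
        rw [if_neg (fun h' => hj (Fin.ext h')), zero_mul]
      · simp
  choose w hw using key
  exact ⟨w, funext hw⟩

variable (L) in
/-- The matrix of multiplication by `τ ^ k` on the same module. -/
def DrinfeldModule.tauPowMatrix (s : ℕ) : ℕ → Matrix (Fin s) (Fin s) L[X]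
  | 0 => 1
  | k + 1 => (tauPowMatrix s k).map (twist Fq 1) * φ.tauMatrix L s

/-- The product `Φ^(k) ⋯ Φ^(1) Φ` can be split off at either end. Comparing the two splittings at `k
= d` gives `Θ^(1) Φ = Φ Θ`. -/
theorem DrinfeldModule.tauPowMatrix_succ' (s k : ℕ) :
    φ.tauPowMatrix L s (k + 1) = (φ.tauMatrix L s).map (twist Fq k) * φ.tauPowMatrix L s k := by
  induction k with
  | zero =>
    have h : (φ.tauMatrix L s).map (twist Fq 0) = φ.tauMatrix L s := by
      ext1 i j; exact twist_zero _ _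
    rw [h]
    simp [tauPowMatrix]
  | succ k ih =>
    have h : ((φ.tauMatrix L s).map (twist Fq k)).map (twist Fq 1) =
        (φ.tauMatrix L s).map (twist Fq (k + 1)) := by
      ext1 i j
      rw [Matrix.map_apply, Matrix.map_apply, Matrix.map_apply, twist_twist, add_comm]
    have h' : ∀ j, φ.tauPowMatrix L s (j + 1) =
        (φ.tauPowMatrix L s j).map (twist Fq 1) * φ.tauMatrix L s := fun _ => rfl
    rw [h' (k + 1), congrArg (fun N => N.map (twist Fq 1)) ih, Matrix.map_mul, h, mul_assoc, ← h' k]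

theorem DrinfeldModule.tauPowMatrix_mulVec [IsScalarTower Fq Fq[X] L] {s : ℕ}
    (hs : ∀ k, s < k → algebraMap Fq[X] L (φ.brac X k) = 0)
    (hs' : algebraMap Fq[X] L (φ.brac X s) ≠ 0) (a : Fq[X]) (x : L) (hx : φ.act L a x = 0)
    (k : ℕ) :
    ∃ w : Fin s → L[X], (φ.tauPowMatrix L s k).mulVec (φ.genVec s a x) =
      twist Fq k ∘ φ.genVec s a x + a.map (algebraMap Fq L) • w := by
  induction k with
  | zero =>
    refine ⟨0, ?_⟩
    rw [tauPowMatrix, Matrix.one_mulVec, smul_zero, add_zero]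
    ext1 i
    exact (twist_zero _ _).symm
  | succ k ih =>
    obtain ⟨w, hw⟩ := φ.tauMatrix_mulVec hs hs' a x hx
    obtain ⟨v, hv⟩ := ih
    refine ⟨twist Fq 1 ∘ v + ((φ.tauPowMatrix L s k).map (twist Fq 1)).mulVec w, ?_⟩
    have h : ((φ.tauPowMatrix L s k).map (twist Fq 1)).mulVec (twist Fq 1 ∘ φ.genVec s a x) =
        twist Fq 1 ∘ ((φ.tauPowMatrix L s k).mulVec (φ.genVec s a x)) := by
      ext1 i
      exact (RingHom.map_mulVec (twist Fq 1) _ _ i).symm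
    rw [tauPowMatrix, ← Matrix.mulVec_mulVec, hw, Matrix.mulVec_add, Matrix.mulVec_smul, h, hv,
      smul_add, ← add_assoc]
    congr 1
    ext1 i
    simp only [Function.comp_apply, Pi.add_apply, Pi.smul_apply, smul_eq_mul, map_add, map_mul,
      twist_map, twist_twist]
    rw [add_comm 1 k]

/-- In the first column only the last entry is nonzero, and its minor is the identity. -/
theorem DrinfeldModule.det_tauMatrix (n : ℕ) :
    (φ.tauMatrix L (n + 1)).det = (-1) ^ n * (C (algebraMap Fq[X] L (φ.brac X (n + 1)))⁻¹ *
      (X - C (algebraMap Fq[X] L X))) := by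
  rw [Matrix.det_succ_column_zero, Finset.sum_eq_single (Fin.last n)]
  · have h : (φ.tauMatrix L (n + 1)).submatrix (Fin.last n).succAbove Fin.succ = 1 := by
      ext1 i j
      have hi : (i : ℕ) + 1 ≠ n + 1 := by have := i.2; omega
      rw [Matrix.submatrix_apply, Fin.succAbove_last, tauMatrix, Fin.val_castSucc, if_neg hi,
        Fin.val_succ, Matrix.one_apply]
      refine if_congr ?_ rfl rfl
      rw [Fin.ext_iff]
      omega
    have h0 : φ.brac X 0 = X := φ.coeff_zero
    rw [h, Matrix.det_one, mul_one, tauMatrix, if_pos (by simp), if_pos (by simp), Fin.val_last,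
      Fin.val_zero, h0]
  · intro i _ hi
    have hi' : (i : ℕ) + 1 ≠ n + 1 := fun h => hi (Fin.ext (by rw [Fin.val_last]; omega))
    rw [tauMatrix, if_neg hi', if_neg (by simp), mul_zero, zero_mul]
  · simp

theorem DrinfeldModule.det_tauPowMatrix_succ (s k : ℕ) :
    (φ.tauPowMatrix L s (k + 1)).det =
      twist Fq 1 (φ.tauPowMatrix L s k).det * (φ.tauMatrix L s).det := by
  rw [tauPowMatrix, Matrix.det_mul, RingHom.map_det]
  rfl

/-- Twisting preserves degrees, so each of the `k` factors contributes `1`. -/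
theorem DrinfeldModule.natDegree_det_tauPowMatrix {s : ℕ} (hs0 : 1 ≤ s)
    (hs' : algebraMap Fq[X] L (φ.brac X s) ≠ 0) (k : ℕ) :
    (φ.tauPowMatrix L s k).det ≠ 0 ∧ (φ.tauPowMatrix L s k).det.natDegree = k := by
  obtain ⟨n, rfl⟩ : ∃ n, s = n + 1 := ⟨s - 1, by omega⟩
  have hε : ((-1) ^ n * C (algebraMap Fq[X] L (φ.brac X (n + 1)))⁻¹ : L[X]) =
      C ((-1) ^ n * (algebraMap Fq[X] L (φ.brac X (n + 1)))⁻¹) := by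
    simp
  have hε0 : (-1) ^ n * (algebraMap Fq[X] L (φ.brac X (n + 1)))⁻¹ ≠ 0 :=
    mul_ne_zero (by simp) (inv_ne_zero hs')
  have hd : (φ.tauMatrix L (n + 1)).det ≠ 0 ∧ (φ.tauMatrix L (n + 1)).det.natDegree = 1 := by
    rw [det_tauMatrix, ← mul_assoc, hε]
    exact ⟨mul_ne_zero (C_ne_zero.mpr hε0) (X_sub_C_ne_zero _),
      by rw [natDegree_C_mul hε0, natDegree_X_sub_C]⟩
  induction k with
  | zero => simp [tauPowMatrix]
  | succ k ih =>
    rw [det_tauPowMatrix_succ]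
    have h := twist_ne_zero Fq 1 ih.1
    exact ⟨mul_ne_zero h hd.1, by rw [natDegree_mul h hd.1, natDegree_twist, ih.2, hd.2]⟩

/-- The rightmost factor is `Φ` itself, untwisted, and its determinant is a multiple of `t - θ`. -/
theorem DrinfeldModule.eval_det_tauPowMatrix {s : ℕ} (hs0 : 1 ≤ s) (k : ℕ) :
    (φ.tauPowMatrix L s (k + 1)).det.eval (algebraMap Fq[X] L X) = 0 := by
  obtain ⟨n, rfl⟩ : ∃ n, s = n + 1 := ⟨s - 1, by omega⟩
  rw [det_tauPowMatrix_succ, det_tauMatrix]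
  simp

theorem DrinfeldModule.tauMatrix_map_twist (s : ℕ) {d : ℕ} (hd : ∀ a : Fq[X],
    algebraMap Fq[X] L a ^ (Fintype.card Fq ^ d) = algebraMap Fq[X] L a) :
    (φ.tauMatrix L s).map (twist Fq d) = φ.tauMatrix L s := by
  ext1 i j
  rw [Matrix.map_apply, tauMatrix]
  split_ifs <;> simp [twist_C, twist_X, hd]

/-- `Θ^(1) Φ = Φ Θ` with `det Φ ≠ 0`, so twisting fixes the characteristic polynomial of `Θ`. -/
theorem DrinfeldModule.exists_charpoly_eq {s : ℕ} (hs0 : 1 ≤ s)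
    (hs' : algebraMap Fq[X] L (φ.brac X s) ≠ 0) {d : ℕ} (hd : ∀ a : Fq[X],
      algebraMap Fq[X] L a ^ (Fintype.card Fq ^ d) = algebraMap Fq[X] L a) :
    ∃ P : Fq[X][X], P.map (mapRingHom (algebraMap Fq L)) = (φ.tauPowMatrix L s d).charpoly := by
  refine exists_map_eq_of_twist_eq Fq _ ?_
  rw [← Matrix.charpoly_map]
  refine charpoly_eq_of_mul_eq_mul (S := φ.tauMatrix L s) ?_ (IsRegular.of_ne_zero ?_)
  · have h := φ.tauPowMatrix_succ' (L := L) s d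
    rw [tauMatrix_map_twist φ s hd, tauPowMatrix] at h
    exact h
  · have h := (φ.natDegree_det_tauPowMatrix hs0 hs' 1).1
    simpa [tauPowMatrix] using h

theorem DrinfeldModule.act_pow_card {d : ℕ} (hd : ∀ a : Fq[X],
      algebraMap Fq[X] L a ^ (Fintype.card Fq ^ d) = algebraMap Fq[X] L a) (a : Fq[X]) (x : L) :
    φ.act L a (x ^ (Fintype.card Fq ^ d)) = φ.act L a x ^ (Fintype.card Fq ^ d) := by
  rw [← frobPow_apply Fq d (φ.act L a x), act_apply, act_apply, twistedAction_apply,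
    twistedAction_apply, map_sum]
  refine Finset.sum_congr rfl fun k _ => ?_
  rw [map_mul, frobPow_apply, frobPow_apply, hd, ← pow_mul, ← pow_mul,
    mul_comm (Fintype.card Fq ^ d)]

theorem DrinfeldModule.genVec_pow_card (s : ℕ) {d : ℕ} (hd : ∀ a : Fq[X],
      algebraMap Fq[X] L a ^ (Fintype.card Fq ^ d) = algebraMap Fq[X] L a) (a : Fq[X]) (x : L) :
    φ.genVec s a (x ^ (Fintype.card Fq ^ d)) = twist Fq d ∘ φ.genVec s a x := by
  ext1 i
  rw [Function.comp_apply, genVec, genVec, twist_twist, add_comm, ← twist_twist]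
  congr 1
  ext m
  rw [coeff_twist, coeff_gen, coeff_gen, act_pow_card φ hd]

end GeneratingPolynomial

/-! ### Invertibility of the matrix of generating polynomials -/

section Independence

variable {Fq : Type*} [Field Fq] [Fintype Fq]
  {L : Type*} [Field L] [IsAlgClosed L] [Algebra Fq L] [Algebra Fq[X] L] [IsScalarTower Fq Fq[X] L]
  {r : ℕ} (φ : DrinfeldModule Fq r)

theorem natDegree_iterate_divX (a : Fq[X]) (n : ℕ) :
    (divX^[n] a).natDegree = a.natDegree - n := by
  induction n with
  | zero => rfl
  | succ n ih =>
    rw [Function.iterate_succ_apply', natDegree_divX_eq_natDegree_tsub_one, ih, Nat.sub_sub]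

theorem iterate_divX_ne_zero (a : Fq[X]) (n : ℕ) (hn : n ≤ a.natDegree) (ha : a ≠ 0) :
    divX^[n] a ≠ 0 := by
  intro h
  have h1 := coeff_iterate_divX a n (a.natDegree - n)
  rw [h, Polynomial.coeff_zero, Nat.sub_add_cancel hn, coeff_natDegree] at h1
  exact leadingCoeff_ne_zero.mpr ha h1.symm

/-- As a function of `x` the sum is a polynomial `H`. Its nonzero terms have distinct degrees, so `H
≠ 0`; its degree is below `q^(s deg a)`, the number of points of `φ[a]`, so `H` cannot vanish on all
of them. -/
theorem DrinfeldModule.exists_sum_eval_genVec_ne_zero {s : ℕ} (hs0 : 1 ≤ s)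
    (hs : ∀ k, s < k → algebraMap Fq[X] L (φ.brac X k) = 0)
    (hs' : algebraMap Fq[X] L (φ.brac X s) ≠ 0) {a : Fq[X]} (ha : algebraMap Fq[X] L a ≠ 0)
    (hN : 0 < a.natDegree) (c : Fin s → L) (hc : c ≠ 0) (ζ : L) :
    ∃ x, φ.act L a x = 0 ∧ ∑ i, c i * (φ.genVec s a x i).eval ζ ≠ 0 := by
  by_contra! hcon
  have ha0 : a ≠ 0 := by rintro rfl; simp at ha
  have hq : 1 < Fintype.card Fq := Fintype.one_lt_card
  let N := a.natDegree
  let T : Fin s × ℕ → L[X] := fun p =>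
    C (c p.1 * ζ ^ p.2) * linearized L (φ.toAlgHom (divX^[p.2 + 1] a)) ^
      (Fintype.card Fq ^ (p.1 : ℕ))
  let S := (Finset.univ : Finset (Fin s)) ×ˢ Finset.range N
  have hT : ∀ p ∈ S, T p ≠ 0 →
      (T p).natDegree = Fintype.card Fq ^ (s * (N - (p.2 + 1)) + p.1) := by
    intro p hp hp0
    have hp2 : p.2 < N := by simpa [S] using hp
    have hcoef : c p.1 * ζ ^ p.2 ≠ 0 := by
      intro h0
      apply hp0
      simp only [T, h0, C_0, zero_mul]
    have h1 := φ.natDegree_linearized L hs0 hs hs'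
      (iterate_divX_ne_zero a (p.2 + 1) hp2 ha0)
    rw [natDegree_C_mul hcoef, natDegree_pow, h1, natDegree_iterate_divX, ← pow_add, add_comm]
  -- The exponent `s (N - m - 1) + i` with `i < s` determines `i` modulo `s`, and then `m`.
  have hdis : Set.Pairwise {p | p ∈ S ∧ T p ≠ 0} (Function.onFun Ne (natDegree ∘ T)) := by
    rintro p ⟨hp, hp0⟩ p' ⟨hp', hp0'⟩ hne heq
    apply hne
    simp only [Function.comp_apply] at heq
    rw [hT p hp hp0, hT p' hp' hp0'] at heq
    have heq := Nat.pow_right_injective hq heq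
    have hlt := p.1.2
    have hlt' := p'.1.2
    have hp2 : p.2 < N := by simpa [S] using hp
    have hp2' : p'.2 < N := by simpa [S] using hp'
    have hmod := congrArg (· % s) heq
    simp only [Nat.mul_add_mod, Nat.mod_eq_of_lt hlt, Nat.mod_eq_of_lt hlt'] at hmod
    rw [hmod, Nat.add_right_cancel_iff] at heq
    have := Nat.eq_of_mul_eq_mul_left hs0 heq
    exact Prod.ext (Fin.ext hmod) (by omega)
  let H := ∑ p ∈ S, T p
  have hHdeg : H.natDegree = S.sup fun p => (T p).natDegree :=
    natDegree_sum_eq_of_disjoint T S hdis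
  have hH0 : H ≠ 0 := by
    obtain ⟨i, hi⟩ := Function.ne_iff.mp hc
    -- With `m = 0` the factor `ζ^m` is `1`, so this term survives even when `ζ = 0`.
    have hmem : (i, 0) ∈ S := by simpa [S] using hN
    have hTne : T (i, 0) ≠ 0 := by
      have h1 := φ.natDegree_linearized L hs0 hs hs'
        (iterate_divX_ne_zero a (0 + 1) hN ha0)
      have h2 : linearized L (φ.toAlgHom (divX^[0 + 1] a)) ≠ 0 := by
        intro h; rw [h, natDegree_zero] at h1
        exact (Nat.pow_pos Fintype.card_pos).ne h1
      exact mul_ne_zero (by simpa using hi) (pow_ne_zero _ h2)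
    intro h0
    rw [h0, natDegree_zero] at hHdeg
    have h3 : (T (i, 0)).natDegree ≤ S.sup fun p => (T p).natDegree :=
      Finset.le_sup (f := fun p => (T p).natDegree) hmem
    rw [← hHdeg, hT _ hmem hTne] at h3
    exact absurd (Nat.pow_pos Fintype.card_pos) (not_lt.mpr h3)
  have hHlt : H.natDegree < Fintype.card Fq ^ (s * N) := by
    rw [hHdeg, Finset.sup_lt_iff (by positivity)]
    intro p hp
    by_cases hp0 : T p = 0
    · rw [hp0, natDegree_zero]; positivity
    rw [hT p hp hp0]
    refine Nat.pow_lt_pow_right hq ?_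
    have hlt := p.1.2
    have hp2 : p.2 < N := by simpa [S] using hp
    calc s * (N - (p.2 + 1)) + p.1 < s * (N - (p.2 + 1)) + s := by omega
      _ = s * (N - (p.2 + 1) + 1) := by ring
      _ ≤ s * N := Nat.mul_le_mul_left _ (by omega)
  have hcard := φ.card_torsion L hs0 hs hs' ha
  have : Finite {x : L // φ.act L a x = 0} := Nat.finite_of_card_ne_zero (by
    rw [hcard]; positivity)
  let _ : Fintype {x : L // φ.act L a x = 0} := Fintype.ofFinite _
  refine hH0 (eq_zero_of_natDegree_lt_card_of_eval_eq_zero H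
    (f := fun x : {x : L // φ.act L a x = 0} => (x : L)) Subtype.val_injective ?_ ?_)
  · intro x
    refine Eq.trans ?_ (hcon x.1 x.2)
    simp only [H, T, S, Finset.sum_product, eval_finsetSum, eval_mul, eval_C, eval_pow,
      eval_linearized, ← DrinfeldModule.act_apply]
    refine Finset.sum_congr rfl fun i _ => ?_
    have hdeg : (twist Fq i (φ.gen a x.1)).natDegree < N := by
      rw [natDegree_twist]
      refine lt_of_le_of_lt (natDegree_sum_le_of_forall_le (n := N - 1) _ _ fun m hm => ?_) (by omega)
      have := Finset.mem_range.mp hm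
      exact (natDegree_monomial_le _).trans (by omega)
    rw [genVec, eval_eq_sum_range' hdeg, Finset.mul_sum]
    refine Finset.sum_congr rfl fun m _ => ?_
    rw [coeff_twist, coeff_gen]
    ring
  · rw [← Nat.card_eq_fintype_card, hcard]
    exact hHlt

/-- At a common zero `ζ` of the determinant and `a(t)`, some nonzero row `c` would kill the vectors
of all `x j`. Since `a(ζ) = 0`, linearity modulo `a` extends this to all of `φ[a]`, against
`exists_sum_eval_genVec_ne_zero`. -/
theorem DrinfeldModule.isCoprime_det_genVec {s : ℕ} (hs0 : 1 ≤ s)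
    (hs : ∀ k, s < k → algebraMap Fq[X] L (φ.brac X k) = 0)
    (hs' : algebraMap Fq[X] L (φ.brac X s) ≠ 0) {a : Fq[X]} (ha : algebraMap Fq[X] L a ≠ 0)
    (x : Fin s → L) (hx : ∀ j, φ.act L a (x j) = 0)
    (hspan : ∀ y, φ.act L a y = 0 → ∃ b : Fin s → Fq[X], ∑ j, φ.act L (b j) (x j) = y) :
    IsCoprime (Matrix.of fun i j => φ.genVec s a (x j) i).det (a.map (algebraMap Fq L)) := by
  rw [isCoprime_iff_aeval_ne_zero_of_isAlgClosed L L]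
  intro ζ
  by_contra! hζ
  obtain ⟨h1, h2⟩ := hζ
  rw [coe_aeval_eq_eval] at h1 h2
  have hN : 0 < a.natDegree := by
    rw [Nat.pos_iff_ne_zero]
    intro h0
    obtain ⟨c, rfl⟩ := natDegree_eq_zero.mp h0
    rw [map_C, eval_C, map_eq_zero] at h2
    rw [h2, C_0, map_zero] at ha
    exact ha rfl
  rw [← coe_evalRingHom, RingHom.map_det, ← Matrix.exists_vecMul_eq_zero_iff] at h1
  obtain ⟨c, hc, hc0⟩ := h1
  obtain ⟨y, hy, hy0⟩ := φ.exists_sum_eval_genVec_ne_zero hs0 hs hs' ha hN c hc ζ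
  apply hy0
  obtain ⟨b, rfl⟩ := hspan y hy
  have hgen : ∀ i j, (φ.genVec s a (φ.act L (b j) (x j)) i).eval ζ =
      ((b j).map (algebraMap Fq L)).eval ζ * (φ.genVec s a (x j) i).eval ζ := by
    intro i j
    obtain ⟨w, hw⟩ := φ.dvd_genVec_act_sub s a (b j) (x j) (hx j) i
    have h := congrArg (eval ζ) hw
    rw [eval_mul, h2, zero_mul, eval_sub, eval_mul, sub_eq_zero] at h
    exact h
  have hcol : ∀ j, ∑ i, c i * (φ.genVec s a (x j) i).eval ζ = 0 := fun j => congrFun hc0 j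
  calc ∑ i, c i * (φ.genVec s a (∑ j, φ.act L (b j) (x j)) i).eval ζ
      = ∑ i, ∑ j, ((b j).map (algebraMap Fq L)).eval ζ *
          (c i * (φ.genVec s a (x j) i).eval ζ) := by
        refine Finset.sum_congr rfl fun i _ => ?_
        rw [genVec_sum, eval_finsetSum, Finset.mul_sum]
        refine Finset.sum_congr rfl fun j _ => ?_
        rw [hgen, mul_left_comm]
    _ = 0 := by
        rw [Finset.sum_comm]
        refine Finset.sum_eq_zero fun j _ => ?_
        rw [← Finset.mul_sum, hcol, mul_zero]

end Independence

/-! ### Comparison with the Tate module -/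

section Charpoly

variable {Fq : Type*} [Field Fq] [Fintype Fq]
  {L : Type*} [Field L] [IsAlgClosed L] [Algebra Fq L] [Algebra Fq[X] L] [IsScalarTower Fq Fq[X] L]
  {r : ℕ} (φ : DrinfeldModule Fq r)

theorem finite_quotient {l : Fq[X]} (hl : l ≠ 0) : Finite (Fq[X] ⧸ Ideal.span {l}) := by
  let pb := AdjoinRoot.powerBasis hl
  have : Module.Finite Fq (AdjoinRoot l) := pb.finite
  exact (Module.finite_of_finite Fq : Finite (AdjoinRoot l))

theorem natCard_quotient {l : Fq[X]} (hl : l ≠ 0) :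
    Nat.card (Fq[X] ⧸ Ideal.span {l}) = Fintype.card Fq ^ l.natDegree := by
  let pb := AdjoinRoot.powerBasis hl
  have : Module.Finite Fq (AdjoinRoot l) := pb.finite
  have h := Module.natCard_eq_pow_finrank (K := Fq) (V := AdjoinRoot l)
  rw [pb.finrank, AdjoinRoot.powerBasis_dim, Nat.card_eq_fintype_card (α := Fq)] at h
  exact h

/-- The Tate module at a prime `l` different from the characteristic is free of rank the rank of
the reduction. -/
theorem DrinfeldModule.exists_basis_tateModule {s : ℕ} (hs0 : 1 ≤ s)
    (hs : ∀ k, s < k → algebraMap Fq[X] L (φ.brac X k) = 0)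
    (hs' : algebraMap Fq[X] L (φ.brac X s) ≠ 0) {l : Fq[X]} (hirr : Irreducible l)
    (hl : algebraMap Fq[X] L l ≠ 0) :
    ∃ b : Module.Basis (Fin s) (AdicCompletion (Ideal.span {l}) Fq[X]) (TateModule l (φ.Points L)),
      ∀ (n : ℕ) (x : φ.Points L), l ^ n • x = 0 →
        ∃ a : Fin s → Fq[X], ∑ i, a i • (b i).term n = x := by
  have : (Ideal.span {l}).IsMaximal := PrincipalIdealRing.isMaximal_of_irreducible hirr
  have : Finite (Fq[X] ⧸ Ideal.span {l}) := finite_quotient hirr.ne_zero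
  refine TateModule.exists_basis_of_card (φ.act_surjective L hs0 hs hs' hirr.ne_zero) s ?_
  rw [natCard_quotient hirr.ne_zero, ← pow_mul, mul_comm]
  exact φ.card_torsion L hs0 hs hs' hl

/-- The characteristic polynomial of `τ ^ d` on the Tate module is that of the matrix of `τ ^ d` on
`L[τ]` as an `L[t]`-module. -/
theorem DrinfeldModule.charpoly_map_eq {s : ℕ} (hs0 : 1 ≤ s)
    (hs : ∀ k, s < k → algebraMap Fq[X] L (φ.brac X k) = 0)
    (hs' : algebraMap Fq[X] L (φ.brac X s) ≠ 0) {d : ℕ} (hd : ∀ a : Fq[X],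
      algebraMap Fq[X] L a ^ (Fintype.card Fq ^ d) = algebraMap Fq[X] L a)
    (P : Fq[X][X])
    (hP : P.map (mapRingHom (algebraMap Fq L)) = (φ.tauPowMatrix L s d).charpoly)
    (g : φ.Points L →ₗ[Fq[X]] φ.Points L)
    (hg : ∀ x : L, g (φ.toPoints L x) = φ.toPoints L (x ^ (Fintype.card Fq ^ d)))
    {l : Fq[X]} (hirr : Irreducible l) (hl : algebraMap Fq[X] L l ≠ 0) :
    ∃ (_ : Module.Free (AdicCompletion (Ideal.span {l}) Fq[X]) (TateModule l (φ.Points L)))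
      (_ : Module.Finite (AdicCompletion (Ideal.span {l}) Fq[X]) (TateModule l (φ.Points L))),
      (TateModule.map (l := l) g).charpoly =
        P.map (algebraMap Fq[X] (AdicCompletion (Ideal.span {l}) Fq[X])) := by
  obtain ⟨b, hb⟩ := φ.exists_basis_tateModule hs0 hs hs' hirr hl
  refine ⟨Module.Free.of_basis b, Module.Finite.of_basis b, ?_⟩
  have := Module.Free.of_basis b
  have := Module.Finite.of_basis b
  let M := LinearMap.toMatrix b b (TateModule.map (l := l) g)
  rw [← LinearMap.charpoly_toMatrix _ b]
  ext1 k
  refine AdicCompletion.ext_evalₐ (I := Ideal.span {l}) fun n => ?_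
  let I : Ideal L[X] := Ideal.span {(l ^ n).map (algebraMap Fq L)}
  let ι : Fq[X] →+* L[X] := mapRingHom (algebraMap Fq L)
  let ψ₀ : Fq[X] ⧸ (Ideal.span {l} ^ n) →+* L[X] ⧸ I :=
    Ideal.Quotient.lift _ ((Ideal.Quotient.mk I).comp ι) (by
      intro a ha
      rw [Ideal.span_singleton_pow, Ideal.mem_span_singleton] at ha
      rw [RingHom.comp_apply, Ideal.Quotient.eq_zero_iff_mem, Ideal.mem_span_singleton]
      exact Polynomial.map_dvd _ ha)
  -- Divisibility descends along `Fq[t] ⊆ L[t]`, so equality modulo `l^n` may be tested over `L`.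
  have hψ₀ : Function.Injective ψ₀ := by
    rw [injective_iff_map_eq_zero]
    intro z hz
    obtain ⟨a, rfl⟩ := Ideal.Quotient.mk_surjective z
    rw [Ideal.Quotient.lift_mk, RingHom.comp_apply, Ideal.Quotient.eq_zero_iff_mem,
      Ideal.mem_span_singleton] at hz
    rw [Ideal.Quotient.eq_zero_iff_mem, Ideal.span_singleton_pow, Ideal.mem_span_singleton]
    exact (Polynomial.map_dvd_map' (algebraMap Fq L)).mp hz
  let ψ : AdicCompletion (Ideal.span {l}) Fq[X] →+* L[X] ⧸ I :=
    ψ₀.comp (AdicCompletion.evalₐ (Ideal.span {l}) n : _ →ₐ[Fq[X]] _).toRingHom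
  have hψ : ∀ z, ψ z = Ideal.Quotient.mk I (ι (TateModule.rep n z)) := by
    intro z
    change ψ₀ (AdicCompletion.evalₐ (Ideal.span {l}) n z) = _
    rw [← TateModule.mk_rep, Ideal.Quotient.lift_mk, RingHom.comp_apply]
  apply hψ₀
  change ψ _ = ψ _
  rw [← coeff_map ψ, ← coeff_map ψ]
  congr 1
  have hPψ : (P.map (algebraMap Fq[X] (AdicCompletion (Ideal.span {l}) Fq[X]))).map ψ =
      ((φ.tauPowMatrix L s d).map (Ideal.Quotient.mk I)).charpoly := by
    rw [Matrix.charpoly_map, ← hP, Polynomial.map_map, Polynomial.map_map]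
    congr 1
  rw [hPψ, ← Matrix.charpoly_map]
  let x : Fin s → L := fun j => (φ.toPoints L).symm ((b j).term n)
  have hx' : ∀ j, (b j).term n = φ.toPoints L (x j) := fun j =>
    ((φ.toPoints L).apply_symm_apply _).symm
  have hx : ∀ j, φ.act L (l ^ n) (x j) = 0 := by
    intro j
    have h := (b j).pow_smul_term n
    rw [hx', smul_eq_act] at h
    exact (φ.toPoints L).map_eq_zero_iff.mp h
  have hsum : ∀ a : Fin s → Fq[X], ∑ j, a j • (b j).term n =
      φ.toPoints L (∑ j, φ.act L (a j) (x j)) := by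
    intro a
    rw [map_sum]
    simp only [hx', smul_eq_act]
  have hspan : ∀ y, φ.act L (l ^ n) y = 0 → ∃ a : Fin s → Fq[X], ∑ j, φ.act L (a j) (x j) = y := by
    intro y hy
    obtain ⟨a, ha⟩ := hb n (φ.toPoints L y) (by rw [smul_eq_act, hy, map_zero])
    rw [hsum] at ha
    exact ⟨a, (φ.toPoints L).injective ha⟩
  -- The relation `τ^d b_j = ∑ M_ij b_i` in the Tate module, read at level `n`.
  have hfrob : ∀ j, x j ^ (Fintype.card Fq ^ d) =
      ∑ i, φ.act L (TateModule.rep n (M i j)) (x i) := by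
    intro j
    apply (φ.toPoints L).injective
    rw [← hg, ← hx', ← hsum]
    have h1 : TateModule.map (l := l) g (b j) = ∑ i, M i j • b i := by
      rw [← b.sum_repr (TateModule.map (l := l) g (b j))]
      refine Finset.sum_congr rfl fun i _ => ?_
      exact congrArg (· • b i) (LinearMap.toMatrix_apply b b _ i j).symm
    have h2 := congrArg (fun t => t.term n) h1
    simp only [TateModule.term_sum, TateModule.smul_term] at h2
    exact h2
  let Ω : Matrix (Fin s) (Fin s) L[X] := Matrix.of fun i j => φ.genVec s (l ^ n) (x j) i
  have hcop : IsCoprime Ω.det ((l ^ n).map (algebraMap Fq L)) :=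
    φ.isCoprime_det_genVec hs0 hs hs' (by rw [map_pow]; exact pow_ne_zero _ hl) x hx hspan
  have hunit : IsUnit (Ω.map (Ideal.Quotient.mk I)).det := by
    obtain ⟨u, v, huv⟩ := hcop
    have h0 : Ideal.Quotient.mk I ((l ^ n).map (algebraMap Fq L)) = 0 :=
      Ideal.Quotient.eq_zero_iff_mem.mpr (Ideal.mem_span_singleton_self _)
    have h1 := congrArg (Ideal.Quotient.mk I) huv
    rw [map_add, map_mul, map_mul, h0, mul_zero, add_zero, map_one, RingHom.map_det] at h1
    exact IsUnit.of_mul_eq_one_right _ h1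
  -- Modulo `l^n`, column `j` of `Θ Ω` is the `d`-th twist of column `j` of `Ω`, which is the vector
  -- of `x_j^(q^d)`. Expanding that point by `hfrob` gives column `j` of `Ω M`.
  refine (charpoly_eq_of_mul_eq_mul (S := Ω.map (Ideal.Quotient.mk I)) ?_ hunit.isRegular).symm
  have hprod : φ.tauPowMatrix L s d * Ω = Matrix.of fun i j =>
      (φ.tauPowMatrix L s d).mulVec (φ.genVec s (l ^ n) (x j)) i := rfl
  rw [← Matrix.map_mul, hprod]
  ext1 i j
  obtain ⟨w, hw⟩ := φ.tauPowMatrix_mulVec hs hs' (l ^ n) (x j) (hx j) d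
  rw [Matrix.map_apply, Matrix.of_apply, hw, ← genVec_pow_card φ s hd, hfrob, Matrix.mul_apply,
    Pi.add_apply, genVec_sum, Pi.smul_apply, smul_eq_mul, map_add, map_mul, map_sum]
  have h0 : Ideal.Quotient.mk I ((l ^ n).map (algebraMap Fq L)) = 0 :=
    Ideal.Quotient.eq_zero_iff_mem.mpr (Ideal.mem_span_singleton_self _)
  rw [h0, zero_mul, add_zero]
  refine Finset.sum_congr rfl fun m _ => ?_
  rw [Matrix.map_apply, Matrix.map_apply, hψ, mul_comm, ← map_mul,
    Ideal.Quotient.eq, Ideal.mem_span_singleton]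
  exact φ.dvd_genVec_act_sub s (l ^ n) _ (x m) (hx m) i

end Charpoly

/-! ### Cayley–Hamilton and the relation satisfied by `τ^d` -/

section Annihilation

variable {Fq : Type*} [Field Fq] [Fintype Fq] {r : ℕ} (φ : DrinfeldModule Fq r)

theorem DrinfeldModule.brac_C_mul (c : Fq) (a : Fq[X]) (k : ℕ) :
    φ.brac (C c * a) k = C c * φ.brac a k := by
  rw [brac, brac, ← smul_eq_C_mul, ← smul_eq_C_mul, map_smul, SkewPolynomial.coeff,
    SkewMonoidAlgebra.coeff_smul]
  rfl

theorem DrinfeldModule.brac_neg (a : Fq[X]) (k : ℕ) : φ.brac (-a) k = -φ.brac a k := by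
  rw [brac, brac, map_neg, SkewPolynomial.coeff_neg]

theorem DrinfeldModule.brac_zero_left (k : ℕ) : φ.brac 0 k = 0 := by
  rw [brac, map_zero, SkewPolynomial.coeff_zero]

theorem coeff_mul_monomial_one (u : TwistedPoly Fq) (m k : ℕ) :
    SkewPolynomial.coeff (u * SkewPolynomial.monomial m 1) k =
      if m ≤ k then SkewPolynomial.coeff u (k - m) else 0 := by
  split_ifs with h
  · refine (SkewMonoidAlgebra.coeff_mul_single_aux u (y := Multiplicative.ofAdd (k - m))
      (fun a => ?_)).trans ?_
    · rw [← Multiplicative.toAdd.injective.eq_iff, ← Multiplicative.toAdd.injective.eq_iff]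
      simp only [toAdd_mul, toAdd_ofAdd]
      omega
    · rw [smul_one, mul_one]
      rfl
  · refine SkewMonoidAlgebra.coeff_mul_single_of_not_exists_mul _ _ fun a ha => h ?_
    have h' := congrArg Multiplicative.toAdd ha
    simp only [toAdd_mul, toAdd_ofAdd] at h'
    omega

theorem coeff_sum_twistedPoly {ι : Type*} (t : Finset ι) (u : ι → TwistedPoly Fq) (k : ℕ) :
    SkewPolynomial.coeff (∑ i ∈ t, u i) k = ∑ i ∈ t, SkewPolynomial.coeff (u i) k := by
  classical
  induction t using Finset.induction_on with
  | empty => rfl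
  | insert i t hi ih =>
    rw [Finset.sum_insert hi, Finset.sum_insert hi, SkewPolynomial.coeff_add, ih]

variable {L : Type*} [Field L] [IsAlgClosed L] [Algebra Fq L] [Algebra Fq[X] L]
  [IsScalarTower Fq Fq[X] L]

/-- If `P` is the characteristic polynomial of `τ ^ d` on the Tate module, the reduction of
`∑_i φ_{P_i} τ ^ (d i)` vanishes. -/
theorem DrinfeldModule.linearized_frobenius_eq_zero {s : ℕ} (hs0 : 1 ≤ s)
    (hs : ∀ k, s < k → algebraMap Fq[X] L (φ.brac X k) = 0)
    (hs' : algebraMap Fq[X] L (φ.brac X s) ≠ 0) (d : ℕ)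
    (g : φ.Points L →ₗ[Fq[X]] φ.Points L)
    (hg : ∀ x : L, g (φ.toPoints L x) = φ.toPoints L (x ^ (Fintype.card Fq ^ d)))
    {l : Fq[X]} (hirr : Irreducible l) (hl : algebraMap Fq[X] L l ≠ 0) (P : Fq[X][X])
    [Module.Free (AdicCompletion (Ideal.span {l}) Fq[X]) (TateModule l (φ.Points L))]
    [Module.Finite (AdicCompletion (Ideal.span {l}) Fq[X]) (TateModule l (φ.Points L))]
    (hP : (TateModule.map (l := l) g).charpoly =
        P.map (algebraMap Fq[X] (AdicCompletion (Ideal.span {l}) Fq[X])))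
    (N : ℕ) (hN : P.natDegree ≤ N) :
    linearized L (∑ i ∈ Finset.range (N + 1),
      φ.toAlgHom (P.coeff i) * SkewPolynomial.monomial (d * i) 1) = 0 := by
  have hdiv : ∀ x : φ.Points L, ∃ y, l • y = x :=
    φ.act_surjective L hs0 hs hs' hirr.ne_zero
  have hpow : ∀ (i : ℕ) (x : L), (g ^ i) (φ.toPoints L x) =
      φ.toPoints L (x ^ (Fintype.card Fq ^ (d * i))) := by
    intro i x
    induction i with
    | zero => simp
    | succ i ih =>
      rw [pow_succ', Module.End.mul_apply, ih, hg, ← pow_mul, ← pow_add]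
      rfl
  have hmap : ∀ (i n : ℕ) (t : TateModule l (φ.Points L)),
      ((TateModule.map (l := l) g ^ i) t).term n = (g ^ i) (t.term n) := by
    intro i n t
    induction i with
    | zero => rfl
    | succ i ih => rw [pow_succ', pow_succ', Module.End.mul_apply, Module.End.mul_apply, ← ih]; rfl
  -- Every `l^n`-torsion point is the `n`-th term of a Tate module element, to which Cayley–Hamilton
  -- applies.
  have hroot : ∀ n x, φ.act L (l ^ n) x = 0 → (linearized L (∑ i ∈ Finset.range (N + 1),
      φ.toAlgHom (P.coeff i) * SkewPolynomial.monomial (d * i) 1)).eval x = 0 := by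
    intro n x hx
    obtain ⟨t, ht⟩ := TateModule.exists_term_eq hdiv n (φ.toPoints L x) (by
      rw [smul_eq_act, hx, map_zero])
    have h := LinearMap.aeval_self_charpoly (TateModule.map (l := l) g)
    rw [hP, aeval_eq_sum_range' (n := N + 1)
      (Nat.lt_succ_of_le ((natDegree_map_le).trans hN))] at h
    have h' := congrArg (fun G => TateModule.term (G t) n) h
    simp only [LinearMap.sum_apply, LinearMap.smul_apply, TateModule.term_sum, coeff_map,
      TateModule.algebraMap_smul_term, hmap, ht, hpow, smul_eq_act, LinearMap.zero_apply,
      TateModule.term_zero'] at h'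
    rw [← map_sum, AddEquiv.map_eq_zero_iff] at h'
    rw [eval_linearized, map_sum, endSum_apply, ← h']
    refine Finset.sum_congr rfl fun i _ => ?_
    rw [twistedAction_mul, twistedAction_monomial, map_one, one_mul, act_apply]
  by_contra hne
  set H := linearized L (∑ i ∈ Finset.range (N + 1),
      φ.toAlgHom (P.coeff i) * SkewPolynomial.monomial (d * i) 1) with hH
  have hq : 1 < Fintype.card Fq := Fintype.one_lt_card
  have hl1 : 1 ≤ l.natDegree := hirr.natDegree_pos
  -- For this `n` the `l^n`-torsion has at least `q^n > deg H` points, all roots of `H`.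
  let n := H.natDegree
  have hcard := φ.card_torsion L hs0 hs hs' (a := l ^ n) (by
    rw [map_pow]; exact pow_ne_zero _ hl)
  have : Finite {x : L // φ.act L (l ^ n) x = 0} := Nat.finite_of_card_ne_zero (by
    rw [hcard]; positivity)
  let _ : Fintype {x : L // φ.act L (l ^ n) x = 0} := Fintype.ofFinite _
  refine hne (eq_zero_of_natDegree_lt_card_of_eval_eq_zero H
    (f := fun x : {x : L // φ.act L (l ^ n) x = 0} => (x : L)) Subtype.val_injective
    (fun x => hroot n x.1 x.2) ?_)
  rw [← Nat.card_eq_fintype_card, hcard, natDegree_pow]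
  calc H.natDegree = n := rfl
    _ < Fintype.card Fq ^ n := Nat.lt_pow_self hq
    _ ≤ Fintype.card Fq ^ (s * (n * l.natDegree)) := by
      refine Nat.pow_le_pow_right hq.le ?_
      calc n = 1 * (n * 1) := by ring
        _ ≤ s * (n * l.natDegree) := Nat.mul_le_mul hs0 (Nat.mul_le_mul_left _ hl1)

end Annihilation

/-! ### The Frobenius polynomial and parts (a) and (b) -/

section ResidueField

variable {Fq : Type*} [Field Fq] [Fintype Fq] {r : ℕ} (φ : DrinfeldModule Fq r)
  (f : Fq[X]) [Fact (Irreducible f)]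

instance : IsScalarTower Fq Fq[X] (ResidueClosure f) := IsScalarTower.of_algebraMap_eq fun c => by
  rw [IsScalarTower.algebraMap_apply Fq[X] (AdjoinRoot f) (ResidueClosure f),
    IsScalarTower.algebraMap_apply Fq (AdjoinRoot f) (ResidueClosure f)]
  rfl

theorem algebraMap_residueClosure_eq_zero_iff (a : Fq[X]) :
    algebraMap Fq[X] (ResidueClosure f) a = 0 ↔ f ∣ a := by
  rw [IsScalarTower.algebraMap_apply Fq[X] (AdjoinRoot f) (ResidueClosure f), map_eq_zero]
  exact AdjoinRoot.mk_eq_zero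

theorem DrinfeldModule.algebraMap_brac_of_reducedRank_lt (k : ℕ) (hk : φ.reducedRank f < k) :
    algebraMap Fq[X] (ResidueClosure f) (φ.brac X k) = 0 := by
  classical
  rw [algebraMap_residueClosure_eq_zero_iff]
  by_cases hkr : r < k
  · have h : φ.brac X k = 0 := φ.coeff_of_rank_lt k hkr
    rw [h]
    exact dvd_zero f
  · by_contra hn
    refine absurd hk (not_lt.mpr ?_)
    have hmem : k ∈ (Finset.Icc 1 r).filter fun k => ¬ f ∣ φ.brac X k :=
      Finset.mem_filter.mpr ⟨Finset.mem_Icc.mpr ⟨by omega, by omega⟩, hn⟩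
    rw [reducedRank]
    convert Finset.le_sup (f := id) hmem using 1
    rfl

theorem DrinfeldModule.algebraMap_brac_reducedRank_ne_zero (h : 1 ≤ φ.reducedRank f) :
    algebraMap Fq[X] (ResidueClosure f) (φ.brac X (φ.reducedRank f)) ≠ 0 := by
  classical
  rw [Ne, algebraMap_residueClosure_eq_zero_iff]
  let S := (Finset.Icc 1 r).filter fun k => ¬ f ∣ φ.brac X k
  have hS : φ.reducedRank f = S.sup id := by
    rw [reducedRank]
  have hne : S.Nonempty := by
    by_contra hn
    rw [Finset.not_nonempty_iff_eq_empty] at hn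
    rw [hS, hn] at h
    simp at h
  obtain ⟨k, hk, hk'⟩ := Finset.exists_mem_eq_sup S hne id
  rw [hS, hk']
  exact (Finset.mem_filter.mp hk).2

theorem DrinfeldModule.frobPoints_toPoints (x : ResidueClosure f) :
    φ.frobPoints f (φ.toPoints _ x) =
      φ.toPoints _ (x ^ (Fintype.card Fq ^ f.natDegree)) := rfl

theorem not_dvd_of_monic_of_ne {f l : Fq[X]} (hf : f.Monic) (hirr : Irreducible f) (hl : l.Monic)
    (hlirr : Irreducible l) (hne : l ≠ f) : ¬ f ∣ l := fun h =>
  hne (eq_of_monic_of_associated hl hf (hirr.associated_of_dvd hlirr h).symm)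

/-- `P` descends from the characteristic polynomial of `Θ`. Its constant term is `± det Θ`, which
has degree `d` and vanishes at `θ`; so it is `f` times a nonzero constant. -/
theorem DrinfeldModule.exists_isFrobeniusPolynomial (hf : f.Monic) :
    ∃ (P : Fq[X][X]) (c : Fqˣ), φ.IsFrobeniusPolynomial f P c := by
  have hirr : Irreducible f := Fact.out
  by_cases h0 : φ.reducedRank f = 0
  · exact ⟨1, 1, monic_one, by rw [h0, natDegree_one], fun _ => rfl, fun h => by omega,
      fun h => by omega⟩
  have hs0 : 1 ≤ φ.reducedRank f := Nat.one_le_iff_ne_zero.mpr h0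
  have hs := φ.algebraMap_brac_of_reducedRank_lt f
  have hs' := φ.algebraMap_brac_reducedRank_ne_zero f hs0
  have hd := algebraMap_residueClosure_pow f
  obtain ⟨P, hP⟩ := φ.exists_charpoly_eq hs0 hs' hd
  have hinj : Function.Injective (mapRingHom (algebraMap Fq (ResidueClosure f))) :=
    map_injective _ (algebraMap Fq (ResidueClosure f)).injective
  have hmonic : P.Monic := by
    apply monic_of_injective hinj
    rw [hP]
    exact Matrix.charpoly_monic _
  have hdeg : P.natDegree = φ.reducedRank f := by
    rw [← natDegree_map_eq_of_injective hinj, hP, Matrix.charpoly_natDegree_eq_dim,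
      Fintype.card_fin]
  obtain ⟨n, hn⟩ : ∃ n, f.natDegree = n + 1 :=
    ⟨f.natDegree - 1, by have := hirr.natDegree_pos; omega⟩
  have hdet := Matrix.det_eq_sign_charpoly_coeff
    (φ.tauPowMatrix (ResidueClosure f) (φ.reducedRank f) f.natDegree)
  rw [← hP, coeff_map, coe_mapRingHom, Fintype.card_fin] at hdet
  obtain ⟨hne, hnat⟩ := φ.natDegree_det_tauPowMatrix (L := ResidueClosure f) hs0 hs' f.natDegree
  have hroot := φ.eval_det_tauPowMatrix (L := ResidueClosure f) hs0 n
  rw [← hn, hdet, eval_mul, mul_eq_zero] at hroot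
  have hsign : ((-1) ^ φ.reducedRank f : (ResidueClosure f)[X]) =
      C ((-1) ^ φ.reducedRank f) := by simp
  have hsign0 : ((-1) ^ φ.reducedRank f : ResidueClosure f) ≠ 0 := by simp
  -- Evaluating `a(t)` at the residue of `θ` gives the residue of `a`, so a zero there means
  -- divisibility by `f`.
  have heval : ∀ a : Fq[X], (a.map (algebraMap Fq (ResidueClosure f))).eval
      (algebraMap Fq[X] (ResidueClosure f) X) = algebraMap Fq[X] (ResidueClosure f) a := by
    intro a
    rw [eval_map_algebraMap, aeval_algebraMap_apply, aeval_X_left_apply]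
  have hdvd : f ∣ P.coeff 0 := by
    rw [← algebraMap_residueClosure_eq_zero_iff, ← heval]
    refine hroot.resolve_left ?_
    rw [hsign, eval_C]
    exact hsign0
  have hP0 : P.coeff 0 ≠ 0 := by
    intro h
    rw [h, Polynomial.map_zero, mul_zero] at hdet
    exact hne hdet
  have hPdeg : (P.coeff 0).natDegree = f.natDegree := by
    rw [← hnat, hdet, hsign, natDegree_C_mul hsign0, natDegree_map]
  obtain ⟨e, he⟩ := hdvd
  have he0 : e ≠ 0 := by rintro rfl; rw [mul_zero] at he; exact hP0 he
  rw [he, natDegree_mul hf.ne_zero he0] at hPdeg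
  obtain ⟨c, rfl⟩ := natDegree_eq_zero.mp (show e.natDegree = 0 by omega)
  have hc0 : c ≠ 0 := by rintro rfl; exact he0 C_0
  refine ⟨P, (Units.mk0 c hc0)⁻¹, hmonic, hdeg, fun h => absurd h h0, fun _ l hl hlirr hlf => ?_,
    fun _ => ?_⟩
  · refine φ.charpoly_map_eq hs0 hs hs' hd P hP (φ.frobPoints f) (φ.frobPoints_toPoints f) hlirr ?_
    rw [Ne, algebraMap_residueClosure_eq_zero_iff]
    exact not_dvd_of_monic_of_ne hf hirr hl hlirr hlf
  · rw [he, inv_inv, Units.val_mk0, mul_comm]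

/-- Here `φ_θ` reduces to `θ`, so each `φ_a` reduces to multiplication by `a`, and `φ_f` to zero. -/
theorem DrinfeldModule.dvd_brac_of_reducedRank_eq_zero (h0 : φ.reducedRank f = 0) (k : ℕ) :
    f ∣ φ.brac f k := by
  have hX : ∀ x, φ.act (ResidueClosure f) X x = algebraMap Fq[X] (ResidueClosure f) X * x := by
    intro x
    rw [φ.act_X _ 0 (fun k hk => φ.algebraMap_brac_of_reducedRank_lt f k (h0 ▸ hk))]
    have h : φ.brac X 0 = X := φ.coeff_zero
    simp [h]
  have hact : ∀ (a : Fq[X]) x,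
      φ.act (ResidueClosure f) a x = algebraMap Fq[X] (ResidueClosure f) a * x := by
    intro a
    induction a using Polynomial.induction_on' with
    | add a b ha hb => intro x; rw [act_add, ha, hb, map_add, add_mul]
    | monomial n c =>
      induction n with
      | zero =>
        intro x
        rw [monomial_zero_left, act_C, ← Polynomial.algebraMap_eq,
          ← IsScalarTower.algebraMap_apply]
      | succ n ih => intro x; rw [← monomial_mul_X, act_mul, ih, hX, map_mul, mul_assoc]
  rw [← algebraMap_residueClosure_eq_zero_iff]
  refine linearized_eq_zero (ResidueClosure f) (φ.toAlgHom f) (Polynomial.funext fun x => ?_) k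
  rw [eval_linearized, ← act_apply, hact, (algebraMap_residueClosure_eq_zero_iff f f).mpr dvd_rfl,
    zero_mul, eval_zero]

theorem exists_monic_irreducible_ne : ∃ l : Fq[X], l.Monic ∧ Irreducible l ∧ l ≠ f := by
  by_cases h : f = X
  · refine ⟨X - C 1, monic_X_sub_C 1, irreducible_X_sub_C 1, fun h' => ?_⟩
    rw [h] at h'
    have := congrArg (eval 0) h'
    simp at this
  · exact ⟨X, monic_X, irreducible_X, fun h' => h h'.symm⟩

/-- The relation `φ_f ≡ ∑_ℓ φ_{b_ℓ} τ ^ (ℓ d)` modulo `f`, on coefficients. -/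
theorem DrinfeldModule.dvd_brac_sub_sum (hf : f.Monic) (P : Fq[X][X]) (c : Fqˣ)
    (h : φ.IsFrobeniusPolynomial f P c) (k : ℕ) :
    f ∣ φ.brac f k - ∑ ℓ ∈ Finset.Icc 1 (k / f.natDegree),
      φ.brac (φ.b f P c ℓ) (k - ℓ * f.natDegree) := by
  have hirr : Irreducible f := Fact.out
  by_cases h0 : φ.reducedRank f = 0
  · rw [Finset.sum_eq_zero, sub_zero]
    · exact φ.dvd_brac_of_reducedRank_eq_zero f h0 k
    · intro ℓ hℓ
      have := (Finset.mem_Icc.mp hℓ).1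
      rw [b, if_neg (by omega), if_neg (by omega), brac_zero_left]
  have hs0 : 1 ≤ φ.reducedRank f := Nat.one_le_iff_ne_zero.mpr h0
  have hs := φ.algebraMap_brac_of_reducedRank_lt f
  have hs' := φ.algebraMap_brac_reducedRank_ne_zero f hs0
  obtain ⟨l, hl, hlirr, hlf⟩ := exists_monic_irreducible_ne f
  have hl0 : algebraMap Fq[X] (ResidueClosure f) l ≠ 0 := by
    rw [Ne, algebraMap_residueClosure_eq_zero_iff]
    exact not_dvd_of_monic_of_ne hf hirr hl hlirr hlf
  obtain ⟨_, _, hchar⟩ := h.isFrobeniusCharpoly hs0 l hl hlirr hlf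
  -- The bound `deg P + k` lets the sum contain every `ℓ ≤ k / d`, even beyond the degree of `P`,
  -- where the coefficients are zero.
  have hlin := φ.linearized_frobenius_eq_zero hs0 hs hs' f.natDegree (φ.frobPoints f)
    (φ.frobPoints_toPoints f) hlirr hl0 P hchar (P.natDegree + k) (Nat.le_add_right _ _)
  have hk := linearized_eq_zero _ _ hlin k
  rw [algebraMap_residueClosure_eq_zero_iff, coeff_sum_twistedPoly] at hk
  simp only [coeff_mul_monomial_one] at hk
  have hd : 0 < f.natDegree := hirr.natDegree_pos
  have hb : ∀ ℓ, 1 ≤ ℓ → C (c : Fq) * P.coeff ℓ = -φ.b f P c ℓ := by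
    intro ℓ hℓ
    rw [b]
    split_ifs with h1 h2
    · rw [neg_neg]
    · rw [neg_neg, h2, ← h.natDegree_eq, h.monic.coeff_natDegree, mul_one]
    · rw [coeff_eq_zero_of_natDegree_lt (by rw [h.natDegree_eq]; omega), mul_zero, neg_zero]
  have hsum : ∑ i ∈ Finset.range (P.natDegree + k + 1), (if f.natDegree * i ≤ k then
      SkewPolynomial.coeff (φ.toAlgHom (P.coeff i)) (k - f.natDegree * i) else 0) =
      φ.brac (P.coeff 0) k + ∑ ℓ ∈ Finset.Icc 1 (k / f.natDegree),
        φ.brac (P.coeff ℓ) (k - ℓ * f.natDegree) := by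
    rw [← Finset.sum_filter]
    have hset : (Finset.range (P.natDegree + k + 1)).filter (fun i => f.natDegree * i ≤ k) =
        insert 0 (Finset.Icc 1 (k / f.natDegree)) := by
      ext i
      rw [Finset.mem_filter, Finset.mem_range, Finset.mem_insert, Finset.mem_Icc,
        Nat.le_div_iff_mul_le hd, mul_comm i]
      constructor
      · rintro ⟨-, h2⟩
        rcases Nat.eq_zero_or_pos i with hi | hi
        · exact Or.inl hi
        · exact Or.inr ⟨hi, h2⟩
      · rintro (rfl | ⟨-, h2⟩)
        · simp
        · have := Nat.le_mul_of_pos_left i hd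
          exact ⟨by omega, h2⟩
    rw [hset, Finset.sum_insert (by simp)]
    congr 1
    refine Finset.sum_congr rfl fun i _ => ?_
    rw [mul_comm]
    rfl
  rw [hsum] at hk
  -- Multiplication by `c` turns the constant term of `P` into `f` and, for `ℓ ≥ 1`, the coefficient
  -- `a_ℓ` into `-b_ℓ`.
  have hfin : φ.brac f k - ∑ ℓ ∈ Finset.Icc 1 (k / f.natDegree),
      φ.brac (φ.b f P c ℓ) (k - ℓ * f.natDegree) =
      C (c : Fq) * (φ.brac (P.coeff 0) k + ∑ ℓ ∈ Finset.Icc 1 (k / f.natDegree),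
        φ.brac (P.coeff ℓ) (k - ℓ * f.natDegree)) := by
    rw [mul_add, Finset.mul_sum, ← brac_C_mul, h.coeff_zero hs0, ← mul_assoc, ← C_mul,
      Units.mul_inv, C_1, one_mul, sub_eq_add_neg, ← Finset.sum_neg_distrib]
    congr 1
    refine Finset.sum_congr rfl fun ℓ hℓ => ?_
    rw [← brac_C_mul, hb ℓ (Finset.mem_Icc.mp hℓ).1, brac_neg]
  rw [hfin]
  exact Dvd.dvd.mul_left hk _

theorem DrinfeldModule.dvd_brac_of_lt (hf : f.Monic) (k : ℕ) (hk : k < f.natDegree) :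
    f ∣ φ.brac f k := by
  obtain ⟨P, c, h⟩ := φ.exists_isFrobeniusPolynomial f hf
  have := φ.dvd_brac_sub_sum f hf P c h k
  rw [Nat.div_eq_of_lt hk] at this
  simpa using this

end ResidueField

/-! ### The Carlitz module modulo `f` -/

section Carlitz

variable {Fq : Type*} [Field Fq] [Fintype Fq] (f : Fq[X]) [Fact (Irreducible f)]

theorem brac_carlitz_X_one : (carlitz Fq).brac X 1 = 1 := by
  rw [DrinfeldModule.brac, carlitz]
  change SkewPolynomial.coeff (aeval _ (X : Fq[X])) 1 = 1
  rw [Polynomial.aeval_X, SkewPolynomial.coeff_add, SkewPolynomial.coeff_monomial,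
    SkewPolynomial.coeff_monomial]
  simp

theorem reducedRank_carlitz : (carlitz Fq).reducedRank f = 1 := by
  classical
  have hirr : Irreducible f := Fact.out
  have h : ¬ f ∣ (carlitz Fq).brac X 1 := by
    rw [brac_carlitz_X_one]
    exact fun h => hirr.not_isUnit (isUnit_of_dvd_one h)
  rw [DrinfeldModule.reducedRank, Finset.Icc_self, Finset.filter_singleton, if_pos h,
    Finset.sup_singleton]
  rfl

/-- The reduction of `C_f` modulo `f` is `τ ^ d`. -/
theorem linearized_carlitz (hf : f.Monic) :
    linearized (ResidueClosure f) ((carlitz Fq).toAlgHom f) =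
      X ^ (Fintype.card Fq ^ f.natDegree) := by
  have hr0 := reducedRank_carlitz f
  have hs := (carlitz Fq).algebraMap_brac_of_reducedRank_lt f
  have hs' := (carlitz Fq).algebraMap_brac_reducedRank_ne_zero f hr0.ge
  rw [hr0] at hs hs'
  obtain ⟨hdeg, hlead⟩ := (carlitz Fq).natDegree_linearized_and_leadingCoeff (ResidueClosure f) 1
    le_rfl hs hs' f.natDegree f hf.ne_zero rfl
  have hlead := hlead (by rw [brac_carlitz_X_one, map_one])
  rw [hf.leadingCoeff, map_one] at hlead
  rw [one_mul] at hdeg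
  -- Below `d` this is part (a) for the Carlitz module; above `d` it is the degree bound.
  have hzero : ∀ k, k ≠ f.natDegree →
      algebraMap Fq[X] (ResidueClosure f) ((carlitz Fq).brac f k) = 0 := by
    intro k hk
    rcases lt_or_gt_of_ne hk with h | h
    · rw [algebraMap_residueClosure_eq_zero_iff]
      exact (carlitz Fq).dvd_brac_of_lt f hf k h
    · rw [DrinfeldModule.brac, ← coeff_linearized]
      apply coeff_eq_zero_of_natDegree_lt
      rw [hdeg]
      exact Nat.pow_lt_pow_right Fintype.one_lt_card h
  have hone : algebraMap Fq[X] (ResidueClosure f) ((carlitz Fq).brac f f.natDegree) = 1 := by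
    rw [DrinfeldModule.brac, ← coeff_linearized, ← hdeg]
    exact hlead
  rw [linearized, Finset.sum_eq_single f.natDegree]
  · change C (algebraMap _ _ ((carlitz Fq).brac f f.natDegree)) * _ = _
    rw [hone, C_1, one_mul]
  · intro k _ hk
    change C (algebraMap _ _ ((carlitz Fq).brac f k)) * _ = _
    rw [hzero k hk, C_0, zero_mul]
  · intro h
    rw [SkewPolynomial.notMem_support_iff.mp h, map_zero, C_0, zero_mul]

theorem linearized_carlitz_pow (hf : f.Monic) (ℓ : ℕ) :
    linearized (ResidueClosure f) ((carlitz Fq).toAlgHom (f ^ ℓ)) =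
      X ^ (Fintype.card Fq ^ (f.natDegree * ℓ)) := by
  induction ℓ with
  | zero =>
    have h := (carlitz Fq).linearized_C (ResidueClosure f) 1
    rw [C_1] at h
    simpa using h
  | succ ℓ ih =>
    rw [pow_succ, map_mul, linearized_mul, ih, linearized_carlitz f hf, pow_comp, X_comp, ← pow_mul,
      ← pow_add, mul_add, mul_one, add_comm]

/-- Over an `A`-algebra in which `f = 0`, the polynomial of `C_{f^ℓ}` is `x ^ (q ^ (d ℓ))`. -/
theorem carlitzPoly_pow_map {B : Type*} [CommRing B] (ρ : Fq[X] →+* B) (hf : f.Monic)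
    (hB : ρ f = 0) (ℓ : ℕ) :
    (carlitzPoly (f ^ ℓ)).map ρ =
      X ^ (Fintype.card Fq ^ (f.natDegree * ℓ)) := by
  have hdvd : ∀ a : Fq[X], f ∣ a → ρ a = 0 := by
    rintro _ ⟨b, rfl⟩
    rw [map_mul, hB, zero_mul]
  -- Coefficients are known in the residue field closure, where zero means divisible by `f`; `ρ f =
  -- 0` transfers this to `B`.
  have hcoeff : ∀ k, algebraMap Fq[X] (ResidueClosure f) ((carlitz Fq).brac (f ^ ℓ) k) =
      if k = f.natDegree * ℓ then 1 else 0 := by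
    intro k
    rw [DrinfeldModule.brac, ← coeff_linearized, linearized_carlitz_pow f hf, coeff_X_pow]
    exact if_congr (card_pow_injective Fq).eq_iff rfl rfl
  have hzero : ∀ k, k ≠ f.natDegree * ℓ →
      ρ ((carlitz Fq).brac (f ^ ℓ) k) = 0 := by
    intro k hk
    apply hdvd
    rw [← algebraMap_residueClosure_eq_zero_iff, hcoeff, if_neg hk]
  have hone : ρ ((carlitz Fq).brac (f ^ ℓ) (f.natDegree * ℓ)) = 1 := by
    rw [← sub_eq_zero, ← map_one ρ, ← map_sub]
    apply hdvd
    rw [← algebraMap_residueClosure_eq_zero_iff, map_sub, hcoeff, if_pos rfl, map_one, sub_self]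
  rw [carlitzPoly, Polynomial.map_sum, Finset.sum_eq_single (f.natDegree * ℓ)]
  · rw [map_monomial, hone, monomial_one_right_eq_X_pow]
  · intro k _ hk
    rw [map_monomial, hzero k hk, monomial_zero_right]
  · intro h
    have h0 : (carlitz Fq).brac (f ^ ℓ) (f.natDegree * ℓ) = 0 :=
      SkewPolynomial.notMem_support_iff.mp h
    rw [h0, map_monomial, map_zero, monomial_zero_right]

end Carlitz

/-- Both sides are additive in `Q`, and on monomials they agree because the power map fixes the
coefficients. -/
theorem pow_card_pow_eq_comp (Fq : Type*) [Field Fq] [Fintype Fq] {B : Type*} [CommRing B]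
    [Algebra Fq B] (m : ℕ) (hB : ∀ z : B, z ^ (Fintype.card Fq ^ m) = z) (Q : B[X]) :
    Q ^ (Fintype.card Fq ^ m) = Q.comp (X ^ (Fintype.card Fq ^ m)) := by
  induction Q using Polynomial.induction_on' with
  | add P Q hP hQ => rw [add_comp, ← hP, ← hQ, ← frob_pow_apply, map_add, frob_pow_apply,
      frob_pow_apply]
  | monomial n z => rw [monomial_pow, hB, monomial_comp, ← pow_mul, ← C_mul_X_pow_eq_monomial,
      mul_comm n]

/-! ### Reduction of `A_(f)` and part (c) -/

section LocalRing

variable {Fq : Type*} [Field Fq] [Fintype Fq] (f : Fq[X]) [Fact (Irreducible f)]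

theorem dvd_pow_card_pow_sub (a : Fq[X]) (ℓ : ℕ) :
    f ∣ a ^ (Fintype.card Fq ^ (f.natDegree * ℓ)) - a := by
  rw [← algebraMap_residueClosure_eq_zero_iff, map_sub, map_pow, sub_eq_zero]
  induction ℓ with
  | zero => simp
  | succ ℓ ih =>
    rw [mul_add, mul_one, pow_add, pow_mul, ih, algebraMap_residueClosure_pow]

/-- An element of `A_(f)` is a fraction `a / t`. The images of `a` and `t` in `B` are fixed by the
power map, and that of `t` is a unit. -/
theorem localRing_quotient_pow {B : Type*} [CommRing B] (π : LocalRing f →+* B)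
    (hsurj : Function.Surjective π) (hπ : π (algebraMap Fq[X] (LocalRing f) f) = 0) (ℓ : ℕ) (z : B) :
    z ^ (Fintype.card Fq ^ (f.natDegree * ℓ)) = z := by
  obtain ⟨y, rfl⟩ := hsurj z
  obtain ⟨⟨a, t⟩, h⟩ := IsLocalization.surj (Ideal.span {f}).primeCompl y
  have key : ∀ b : Fq[X], π (algebraMap _ _ b) ^ (Fintype.card Fq ^ (f.natDegree * ℓ)) =
      π (algebraMap _ _ b) := by
    intro b
    obtain ⟨e, he⟩ := dvd_pow_card_pow_sub f b ℓ
    rw [← sub_eq_zero, ← map_pow, ← map_pow, ← map_sub, ← map_sub, he, map_mul, map_mul, hπ,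
      zero_mul]
  have hu : IsUnit (π (algebraMap _ _ (t : Fq[X]))) :=
    (IsLocalization.map_units (LocalRing f) t).map π
  have h1 := congrArg π h
  rw [map_mul] at h1
  apply hu.mul_right_cancel
  rw [h1, ← key a, ← h1, mul_pow, key]

/-- Modulo `f`, the substitution of `C_{f^ℓ}` is the `q^(dℓ)`-th power, and the exponents `k - ℓd`
and `dℓ` add up to `k`. -/
theorem map_star_pow {B : Type*} [CommRing B] [Algebra Fq B] (π : LocalRing f →+* B)
    (hsurj : Function.Surjective π) (hπ : π (algebraMap Fq[X] (LocalRing f) f) = 0) (hf : f.Monic)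
    (Q : (LocalRing f)[X]) (k ℓ : ℕ) (hℓk : ℓ * f.natDegree ≤ k) :
    (Drinfeld.star (f ^ ℓ) (Q ^ (Fintype.card Fq ^ (k - ℓ * f.natDegree)))).map π =
      (Q.map π) ^ (Fintype.card Fq ^ k) := by
  rw [Drinfeld.star, Polynomial.map_comp, Polynomial.map_map,
    carlitzPoly_pow_map f (π.comp (algebraMap Fq[X] (LocalRing f))) hf hπ,
    ← pow_card_pow_eq_comp Fq _ (localRing_quotient_pow f π hsurj hπ ℓ), Polynomial.map_pow,
    ← pow_mul, ← pow_add, mul_comm f.natDegree, Nat.sub_add_cancel hℓk]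

/-- After reduction every term is a scalar times the same power of `Q`, and the scalars sum to zero
by `huv`. -/
theorem map_relation {B : Type*} [CommRing B] (π : LocalRing f →+* B)
    (hsurj : Function.Surjective π) (hπ : π (algebraMap Fq[X] (LocalRing f) f) = 0) (hf : f.Monic)
    (u : Fq[X]) (v : ℕ → Fq[X]) (k : ℕ)
    (huv : f ∣ u - ∑ ℓ ∈ Finset.Icc 1 (k / f.natDegree), v ℓ) (Q : (LocalRing f)[X]) :
    (C (algebraMap Fq[X] (LocalRing f) u) * Q ^ (Fintype.card Fq ^ k) -
      ∑ ℓ ∈ Finset.Icc 1 (k / f.natDegree), C (algebraMap Fq[X] (LocalRing f) (v ℓ)) *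
        Drinfeld.star (f ^ ℓ) (Q ^ (Fintype.card Fq ^ (k - ℓ * f.natDegree)))).map π = 0 := by
  -- `B` is an `Fq`-algebra through `A`; this makes the `q`-th power map on polynomials over `B`
  -- additive.
  let _ : Algebra Fq B := ((π.comp (algebraMap Fq[X] (LocalRing f))).comp C).toAlgebra
  have hd : 0 < f.natDegree := (Fact.out : Irreducible f).natDegree_pos
  have hsum : ∀ ℓ ∈ Finset.Icc 1 (k / f.natDegree),
      (C (algebraMap Fq[X] (LocalRing f) (v ℓ)) *
        Drinfeld.star (f ^ ℓ) (Q ^ (Fintype.card Fq ^ (k - ℓ * f.natDegree)))).map π =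
      C (π (algebraMap Fq[X] (LocalRing f) (v ℓ))) * (Q.map π) ^ (Fintype.card Fq ^ k) := by
    intro ℓ hℓ
    rw [Polynomial.map_mul, map_C, map_star_pow f π hsurj hπ hf Q k ℓ
      ((Nat.le_div_iff_mul_le hd).mp (Finset.mem_Icc.mp hℓ).2)]
  have hzero : π (algebraMap Fq[X] (LocalRing f)
      (u - ∑ ℓ ∈ Finset.Icc 1 (k / f.natDegree), v ℓ)) = 0 := by
    obtain ⟨e, he⟩ := huv
    rw [he, map_mul, map_mul, hπ, zero_mul]
  rw [Polynomial.map_sub, Polynomial.map_mul, Polynomial.map_pow, map_C, Polynomial.map_sum,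
    Finset.sum_congr rfl hsum, ← Finset.sum_mul, ← sub_mul, ← map_sum C, ← C_sub, ← map_sum π,
    ← map_sum (algebraMap Fq[X] (LocalRing f)), ← map_sub π, ← map_sub, hzero, C_0, zero_mul]

/-- `R/(x)`, presented only through the properties that the reduction argument needs. -/
theorem exists_quotient_map.{u} {R : Type u} [CommRing R] (x : R) :
    ∃ (B : Type u) (_ : CommRing B) (π : R →+* B),
      Function.Surjective π ∧ π x = 0 ∧ ∀ p : R[X], p.map π = 0 → C x ∣ p := by
  refine ⟨R ⧸ Ideal.span {x}, inferInstance, Ideal.Quotient.mk _, Ideal.Quotient.mk_surjective,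
    Ideal.Quotient.eq_zero_iff_mem.mpr (Ideal.mem_span_singleton_self _), fun p h => ?_⟩
  rw [C_dvd_iff_dvd_coeff]
  intro i
  have hi := congrArg (fun p => p.coeff i) h
  rw [coeff_map, Polynomial.coeff_zero] at hi
  exact Ideal.mem_span_singleton.mp (Ideal.Quotient.eq_zero_iff_mem.mp hi)

theorem C_dvd_relation (hf : f.Monic) (u : Fq[X]) (v : ℕ → Fq[X]) (k : ℕ)
    (huv : f ∣ u - ∑ ℓ ∈ Finset.Icc 1 (k / f.natDegree), v ℓ) (Q : (LocalRing f)[X]) :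
    C (algebraMap Fq[X] (LocalRing f) f) ∣
      C (algebraMap Fq[X] (LocalRing f) u) * Q ^ (Fintype.card Fq ^ k) -
      ∑ ℓ ∈ Finset.Icc 1 (k / f.natDegree), C (algebraMap Fq[X] (LocalRing f) (v ℓ)) *
        Drinfeld.star (f ^ ℓ) (Q ^ (Fintype.card Fq ^ (k - ℓ * f.natDegree))) := by
  obtain ⟨B, _, π, hsurj, hπ, hdvd⟩ := exists_quotient_map (algebraMap Fq[X] (LocalRing f) f)
  exact hdvd _ (map_relation f π hsurj hπ hf u v k huv Q)

end LocalRing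

end Drinfeld

end

open Drinfeld Polynomial in
theorem lemma5p4 {Fq : Type*} [Field Fq] [Fintype Fq] {r : ℕ} (hr : 1 ≤ r)
    (φ : DrinfeldModule Fq r) (f : Fq[X]) (hf : f.Monic) [Fact (Irreducible f)] :
    -- part (a)
    (∀ k : ℕ, k < f.natDegree → f ∣ φ.brac f k) ∧
    -- the characteristic polynomial `P = P_f` and the constant `c = c_f` exist
    (∃ (P : Fq[X][X]) (c : Fqˣ), φ.IsFrobeniusPolynomial f P c) ∧
    ∀ (P : Fq[X][X]) (c : Fqˣ), φ.IsFrobeniusPolynomial f P c →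
      -- part (b)
      (∀ k : ℕ, k ≤ r * f.natDegree →
        f ∣ φ.brac f k -
          ∑ ℓ ∈ Finset.Icc 1 (k / f.natDegree),
            φ.brac (φ.b f P c ℓ) (k - ℓ * f.natDegree)) ∧
      -- part (c)
      (∀ (Q : (LocalRing f)[X]) (k : ℕ), k ≤ r * f.natDegree →
        C (algebraMap Fq[X] (LocalRing f) f) ∣
          C (algebraMap Fq[X] (LocalRing f) (φ.brac f k)) * Q ^ (Fintype.card Fq ^ k) -
          ∑ ℓ ∈ Finset.Icc 1 (k / f.natDegree),
            C (algebraMap Fq[X] (LocalRing f)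
                (φ.brac (φ.b f P c ℓ) (k - ℓ * f.natDegree))) *
              Drinfeld.star (f ^ ℓ)
                (Q ^ (Fintype.card Fq ^ (k - ℓ * f.natDegree)))) := by
  refine ⟨φ.dvd_brac_of_lt f hf, φ.exists_isFrobeniusPolynomial f hf, fun P c h =>
    ⟨fun k _ => φ.dvd_brac_sub_sum f hf P c h k, fun Q k _ => ?_⟩⟩
  exact C_dvd_relation f hf (φ.brac f k)
    (fun ℓ => φ.brac (φ.b f P c ℓ) (k - ℓ * f.natDegree)) k (φ.dvd_brac_sub_sum f hf P c h k) Q
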